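/- For a finite multigraph $G$ let $\pi_G$ be the distribution on its vertices with $\pi_G(v)=\deg(v)/\sum_w\deg(w)$ (a loop contributes $2$ to the degree). Let $f:(0,\infty)\to[0,1]$. The random multigraphs $(G_t)_{t\ge 0}=(G_t(f))_{t\ge0}$ are defined as follows: $G_0$ is one vertex with one loop; given $G_t$, a coin with success probability $f(t+1)$ is tossed, independently of the past. On success a new vertex is added and joined by one edge to a vertex of $G_t$ drawn from $\pi_{G_t}$; otherwise one new edge is added between two vertices of $G_t$ drawn independently from $\pi_{G_t}$ (possibly creating a loop or a multiple edge). Let $\widehat G_t$ be the simple graph obtained from $G_t$ by removing loops and merging multiple edges, let $\Delta_t$ be the number of triangles of $\widehat G_t$ and $\Lambda_t$ the number of its cherries (paths of length two), and let $c^{\rm glob}_t=3\Delta_t/\Lambda_t$ be its global clustering coefficient (read as $0$ if $\Lambda_t=0$). **Theorem.** For every $\delta\in(0,1)$ there are constants $c_1,c_2>0$, depending on $\delta$ only, such that the following holds. Let $\gamma\in[0,1)$ and let $f:(0,\infty)\to(0,1]$ be non-increasing with $\lim_{x\to\infty}f(x)=0$ and regularly varying at infinity with index $-\gamma$, that is,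 $\lim_{x\to\infty}f(ax)/f(x)=a^{-\gamma}$ for every $a>0$. Then there is $t_0=t_0(f,\delta)$ such that for all integers $t\ge t_0$ $$\mathbb P\left(c_1\,t^{-(1-\gamma)(1+\delta)/2}\le c^{\rm glob}_t\le c_2\,t^{-(1-\gamma)(1-\delta)/2}\right)\ \ge\ 1-\frac1{\log t}.$$ -/

import Mathlib

namespace EdgeStep

/-- A finite multigraph with vertex set `{0, …, order - 1}` and at least one edge. The edges form a
multiset of unordered pairs of vertices, so that loops and multiple edges are allowed. -/
structure Multigraph where
  order : ℕ
  edges : Multiset (Sym2 (Fin order))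
  edges_ne_zero : edges ≠ 0

instance : MeasurableSpace Multigraph := ⊤

namespace Multigraph

/-- The degree of a vertex: the number of edge ends at it (a loop counts twice). -/
def degree (G : Multigraph) (v : Fin G.order) : ℕ :=
  (G.edges.map fun e => e.toMultiset.count v).sum

theorem sum_degree (G : Multigraph) : ∑ v, G.degree v = 2 * G.edges.card := by
  have h : ∀ s : Multiset (Sym2 (Fin G.order)),
      ∑ v, (s.map fun e => e.toMultiset.count v).sum = 2 * s.card := by
    intro s
    induction s using Multiset.induction_on with
    | empty => simp
    | cons e s ih =>
      have he : ∑ v, e.toMultiset.count v = 2 := by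
        rw [Multiset.sum_count_eq_card (fun a _ => Finset.mem_univ a), Sym2.card_toMultiset]
      simp only [Multiset.map_cons, Multiset.sum_cons, Finset.sum_add_distrib, he, ih,
        Multiset.card_cons]
      ring
  exact h G.edges

theorem tsum_degree_ne_zero (G : Multigraph) :
    ∑' v : Fin G.order, (G.degree v : ENNReal) ≠ 0 := by
  rw [tsum_fintype, ← Nat.cast_sum, sum_degree]
  simpa using G.edges_ne_zero

theorem tsum_degree_ne_top (G : Multigraph) :
    ∑' v : Fin G.order, (G.degree v : ENNReal) ≠ ⊤ := by
  rw [tsum_fintype, ← Nat.cast_sum]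
  exact ENNReal.natCast_ne_top _

/-- The preferential attachment distribution on the vertices of `G`:
`v` has probability `degree v / ∑ w, degree w`. -/
noncomputable def pi (G : Multigraph) : PMF (Fin G.order) :=
  PMF.normalize (fun v => (G.degree v : ENNReal)) G.tsum_degree_ne_zero G.tsum_degree_ne_top

/-- Add a new vertex (labelled `G.order`) and join it to the vertex `u` by an edge. -/
def addVertex (G : Multigraph) (u : Fin G.order) : Multigraph where
  order := G.order + 1
  edges := s(u.castSucc, Fin.last G.order) ::ₘ G.edges.map (Sym2.map Fin.castSucc)
  edges_ne_zero := Multiset.cons_ne_zero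

/-- Add a new edge between the vertices `u` and `v` (a loop if `u = v`). -/
def addEdge (G : Multigraph) (u v : Fin G.order) : Multigraph where
  order := G.order
  edges := s(u, v) ::ₘ G.edges
  edges_ne_zero := Multiset.cons_ne_zero

/-- The random result of a vertex-operation on `G`. -/
noncomputable def vertexOperation (G : Multigraph) : PMF Multigraph :=
  G.pi.bind fun u => PMF.pure (G.addVertex u)

/-- The random result of an edge-operation on `G`: the two end points are drawn independently. -/
noncomputable def edgeOperation (G : Multigraph) : PMF Multigraph :=
  G.pi.bind fun u => G.pi.bind fun v => PMF.pure (G.addEdge u v)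

/-- The simplification of `G`: loops are removed and multiple edges are merged. -/
def simplification (G : Multigraph) : SimpleGraph (Fin G.order) :=
  SimpleGraph.fromEdgeSet {e | e ∈ G.edges}

end Multigraph

/-- The Bernoulli distribution with parameter `p` (`true` has probability `p`). -/
noncomputable def coin (p : unitInterval) : PMF Bool :=
  PMF.ofFintype (fun b => cond b (ENNReal.ofReal (p : ℝ)) (ENNReal.ofReal (1 - (p : ℝ)))) (by
    rw [Fintype.sum_bool, cond_true, cond_false,
      ← ENNReal.ofReal_add p.2.1 (sub_nonneg.2 p.2.2)]
    simp)

/-- One step of the process: a vertex-operation with probability `p`, otherwise an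
edge-operation. -/
noncomputable def step (p : unitInterval) (G : Multigraph) : PMF Multigraph :=
  (coin p).bind fun z => cond z G.vertexOperation G.edgeOperation

/-- The initial graph: one vertex with a loop. -/
def initialGraph : Multigraph where
  order := 1
  edges := {s(0, 0)}
  edges_ne_zero := Multiset.singleton_ne_zero _

/-- The law of the random multigraph `G_t(f)`: the process starts at `initialGraph`, and `G_{t+1}`
is obtained from `G_t` by one step with parameter `f (t + 1)`, with fresh randomness. Only the values
of `f` at positive arguments matter. -/
noncomputable def graphLaw (f : ℝ → unitInterval) : ℕ → PMF Multigraph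
  | 0 => PMF.pure initialGraph
  | t + 1 => (graphLaw f t).bind (step (f ((t : ℝ) + 1)))

open Classical in
/-- The number of triangles of a finite simple graph. -/
noncomputable def triangles {V : Type*} [Fintype V] (H : SimpleGraph V) : ℕ :=
  (H.cliqueFinset 3).card

open Classical in
/-- The number of cherries (paths of length two) of a finite simple graph: such a path is given by
its middle vertex `v` and the unordered pair `s` of its two end points. -/
noncomputable def cherries {V : Type*} [Fintype V] (H : SimpleGraph V) : ℕ :=
  (Finset.univ.filter fun p : V × Finset V => p.2.card = 2 ∧ ∀ u ∈ p.2, H.Adj p.1 u).card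

/-- The global clustering coefficient `3 Δ / Λ` of the simplification of a multigraph.
It takes the value `0` when there are no cherries. -/
noncomputable def globalClustering (G : Multigraph) : ℝ :=
  3 * ((triangles G.simplification : ℝ) / (cherries G.simplification : ℝ))

/-- `f` is (strictly positive on `(0, ∞)` and) regularly varying at infinity with index `ρ`. -/
def IsRegularlyVarying (f : ℝ → ℝ) (ρ : ℝ) : Prop :=
  (∀ x, 0 < x → 0 < f x) ∧
    ∀ a, 0 < a → Filter.Tendsto (fun x => f (a * x) / f x) Filter.atTop (nhds (a ^ ρ))

end EdgeStep

/-! Put θ = 1 - γ and let ε be a small multiple of θδ. Regular variation and monotonicity squeeze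
f(x) between constant multiples of x^(θ-1-ε) and x^(θ-1+ε). Up to factors t^(O(ε)), the graph at
time t then has t^θ vertices and its simplification has t^θ edges, t^(2θ) cherries and t^(3θ/2)
triangles, whence the exponent -θ/2.

Upper bounds. If the order and the number of ordered adjacent pairs m are at most t^(θ+3ε), then Λ ≤
order · m, and Cauchy–Schwarz gives Δ ≤ m^(3/2) (`card_adjTriples_sq_le`). The point is to bound m,
since most of the t edges are parallel. Vertices of degrees d and d' are joined at rate about
dd'/t², so a link by time t should cost min(1, dd'/t) ≤ (dd'/t)^θ. `avg_linkPotential_le` makes this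
a drift inequality. Since d^θ grows on average by a factor at most 1 + θ/t per step, the sum of
(dd')^θ over all pairs has mean at most about t^(2θ), and so m has mean at most about t^θ
(`exists_ev_linkSum_le`).

Lower bounds. As f tends to 0, almost every step is an edge-operation and the degree of a vertex
present at time s grows almost like t/s. The lower tail is controlled by a supermartingale built on
`decay` (`ev_deg_lt_le`). Vertex 0 therefore has degree at least t^(1-ε) at time t/2 and then
collects t^(θ-3ε) distinct neighbours from vertex-operations, which gives the cherries. By time
t^(1/2-ε) there are N ≈ t^(θ/2-2ε) vertices. By time t/2 such a vertex typically has degree at least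
t^(1/2+ε/2), and two vertices of this degree are almost surely linked by time t. So the first N
vertices nearly form a clique, which gives about N³ triangles.

Probabilities are computed with the backward operator `ev`, a finite sum at every step; conditioning
on an intermediate time is `ev_comp`. Each of the four bad events has probability at most a negative
power of t, hence eventually at most 1/(4 log t). -/

namespace EdgeStep

/-! ### Vertex labels as natural numbers, so that a vertex keeps its name while the graph grows. -/

namespace Multigraph

/-- The edges of `G`, with the vertices regarded as natural numbers. -/
def natEdges (G : Multigraph) : Multiset (Sym2 ℕ) := G.edges.map (Sym2.map Fin.val)

/-- The degree of the vertex with label `n`, which is `0` if there is no such vertex. -/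
def deg (G : Multigraph) (n : ℕ) : ℕ := (G.natEdges.map fun e => e.toMultiset.count n).sum

/-- The probability of the vertex with label `n` under `G.pi`. -/
noncomputable def weight (G : Multigraph) (n : ℕ) : ℝ := G.deg n / (2 * G.edges.card)

theorem count_toMultiset_mk (a b n : ℕ) : (s(a, b)).toMultiset.count n =
    (if a = n then 1 else 0) + (if b = n then 1 else 0) := by
  show Multiset.count n {a, b} = _
  rw [Multiset.insert_eq_cons, Multiset.count_cons, Multiset.count_singleton, add_comm]
  simp only [eq_comm]

theorem natEdges_addVertex (G : Multigraph) (u : Fin G.order) :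
    (G.addVertex u).natEdges = s((u : ℕ), G.order) ::ₘ G.natEdges := by
  simp only [natEdges, addVertex, Multiset.map_cons, Multiset.map_map, Sym2.map_mk]
  congr 1
  refine Multiset.map_congr rfl fun e _ => ?_
  simp only [Function.comp_apply, Sym2.map_map]
  rfl

theorem natEdges_addEdge (G : Multigraph) (u v : Fin G.order) :
    (G.addEdge u v).natEdges = s((u : ℕ), (v : ℕ)) ::ₘ G.natEdges := by
  simp [natEdges, addEdge]

theorem lt_order_of_mem (G : Multigraph) {a b : ℕ} (h : s(a, b) ∈ G.natEdges) :
    a < G.order ∧ b < G.order := by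
  obtain ⟨e, -, he⟩ := Multiset.mem_map.1 h
  induction e using Sym2.ind with
  | _ x y =>
    rw [Sym2.map_mk, Sym2.eq_iff] at he
    rcases he with ⟨rfl, rfl⟩ | ⟨rfl, rfl⟩
    · exact ⟨x.2, y.2⟩
    · exact ⟨y.2, x.2⟩

theorem degree_eq_deg (G : Multigraph) (v : Fin G.order) : G.degree v = G.deg v := by
  rw [degree, deg, natEdges, Multiset.map_map]
  congr 1
  refine Multiset.map_congr rfl fun e _ => ?_
  induction e using Sym2.ind with
  | _ x y =>
    rw [Function.comp_apply, Sym2.map_mk, count_toMultiset_mk]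
    show Multiset.count v {x, y} = _
    rw [Multiset.insert_eq_cons, Multiset.count_cons, Multiset.count_singleton, add_comm]
    simp only [eq_comm, Fin.ext_iff]

theorem deg_addVertex (G : Multigraph) (u : Fin G.order) (n : ℕ) :
    (G.addVertex u).deg n =
      G.deg n + ((if (u : ℕ) = n then 1 else 0) + (if G.order = n then 1 else 0)) := by
  rw [deg, natEdges_addVertex, Multiset.map_cons, Multiset.sum_cons, count_toMultiset_mk, deg,
    add_comm]

theorem deg_addEdge (G : Multigraph) (u v : Fin G.order) (n : ℕ) :
    (G.addEdge u v).deg n =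
      G.deg n + ((if (u : ℕ) = n then 1 else 0) + (if (v : ℕ) = n then 1 else 0)) := by
  rw [deg, natEdges_addEdge, Multiset.map_cons, Multiset.sum_cons, count_toMultiset_mk, deg,
    add_comm]

theorem deg_eq_zero (G : Multigraph) {n : ℕ} (h : G.order ≤ n) : G.deg n = 0 := by
  rw [deg, Multiset.sum_eq_zero_iff]
  intro x hx
  obtain ⟨e, he, rfl⟩ := Multiset.mem_map.1 hx
  induction e using Sym2.ind with
  | _ a b =>
    have := G.lt_order_of_mem he
    rw [count_toMultiset_mk, if_neg (by omega), if_neg (by omega), add_zero]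

theorem card_pos (G : Multigraph) : 0 < (G.edges.card : ℝ) := by
  exact_mod_cast Multiset.card_pos.2 G.edges_ne_zero

theorem weight_nonneg (G : Multigraph) (n : ℕ) : 0 ≤ G.weight n := by
  unfold weight; positivity

theorem sum_weight (G : Multigraph) : ∑ u : Fin G.order, G.weight u = 1 := by
  have := G.card_pos
  simp only [weight, ← Finset.sum_div]
  rw [div_eq_one_iff_eq (by positivity)]
  have h := G.sum_degree
  simp only [degree_eq_deg] at h
  exact_mod_cast h

theorem pi_apply (G : Multigraph) (u : Fin G.order) : G.pi u = ENNReal.ofReal (G.weight u) := by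
  have h := G.card_pos
  rw [pi, PMF.normalize_apply, tsum_fintype, ← Nat.cast_sum, sum_degree, degree_eq_deg, weight,
    ENNReal.ofReal_div_of_pos (by positivity), ENNReal.ofReal_natCast, div_eq_mul_inv]
  congr 2
  rw [← ENNReal.ofReal_natCast]
  push_cast
  rfl

theorem card_addVertex (G : Multigraph) (u : Fin G.order) :
    (G.addVertex u).edges.card = G.edges.card + 1 := by
  simp [addVertex]

theorem card_addEdge (G : Multigraph) (u v : Fin G.order) :
    (G.addEdge u v).edges.card = G.edges.card + 1 := by
  simp [addEdge]

end Multigraph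

/-! ### One-step averages and the backward operator. -/

open Multigraph

/-- The expectation of `h` after one step from `G` with parameter `p`. -/
noncomputable def avg (p : ℝ) (h : Multigraph → ℝ) (G : Multigraph) : ℝ :=
  p * (∑ u : Fin G.order, G.weight u * h (G.addVertex u)) +
    (1 - p) * ∑ u : Fin G.order, ∑ v : Fin G.order, G.weight u * G.weight v * h (G.addEdge u v)

/-- The expectation of `h` after the steps `s + 1, …, s + k`, as a function of the graph at time
`s`. -/
noncomputable def ev (f : ℝ → unitInterval) (s : ℕ) : ℕ → (Multigraph → ℝ) → Multigraph → ℝ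
  | 0, h => h
  | k + 1, h => ev f s k (avg (f (((s + k : ℕ) : ℝ) + 1)) h)

theorem sum_sum_weight (G : Multigraph) :
    ∑ u : Fin G.order, ∑ v : Fin G.order, G.weight u * G.weight v = 1 := by
  simp only [← Finset.mul_sum, sum_weight, mul_one]

theorem avg_const (p c : ℝ) : avg p (fun _ => c) = fun _ => c := by
  funext G
  simp only [avg, ← Finset.sum_mul, sum_weight, sum_sum_weight]
  ring

theorem avg_nonneg {p : ℝ} (hp : p ∈ Set.Icc (0 : ℝ) 1) {h : Multigraph → ℝ} (hh : ∀ G, 0 ≤ h G)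
    (G : Multigraph) : 0 ≤ avg p h G := by
  have := sub_nonneg.2 hp.2
  have := hp.1
  have hw := G.weight_nonneg
  refine add_nonneg (mul_nonneg ‹_› (Finset.sum_nonneg fun u _ => mul_nonneg (hw _) (hh _)))
    (mul_nonneg ‹_› (Finset.sum_nonneg fun u _ => Finset.sum_nonneg fun v _ =>
      mul_nonneg (mul_nonneg (hw _) (hw _)) (hh _)))

theorem avg_add (p : ℝ) (h h' : Multigraph → ℝ) :
    avg p (fun G => h G + h' G) = fun G => avg p h G + avg p h' G := by
  funext G
  simp only [avg, mul_add, Finset.sum_add_distrib]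
  ring

theorem avg_mul_left (p c : ℝ) (h : Multigraph → ℝ) :
    avg p (fun G => c * h G) = fun G => c * avg p h G := by
  funext G
  simp only [avg, mul_left_comm _ c, ← Finset.mul_sum]
  ring

/-- Bounding the expectation after a vertex-operation and after an edge-operation. -/
theorem avg_le {p : ℝ} (hp : p ∈ Set.Icc (0 : ℝ) 1) {h : Multigraph → ℝ} {G : Multigraph}
    {φ : Fin G.order → ℝ} {ψ : Fin G.order → Fin G.order → ℝ}
    (h1 : ∀ u, h (G.addVertex u) ≤ φ u) (h2 : ∀ u v, h (G.addEdge u v) ≤ ψ u v) :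
    avg p h G ≤ p * (∑ u : Fin G.order, G.weight u * φ u) +
      (1 - p) * ∑ u : Fin G.order, ∑ v : Fin G.order, G.weight u * G.weight v * ψ u v := by
  have := sub_nonneg.2 hp.2
  have := hp.1
  have hw := G.weight_nonneg
  refine add_le_add (mul_le_mul_of_nonneg_left (Finset.sum_le_sum fun u _ =>
    mul_le_mul_of_nonneg_left (h1 u) (hw _)) ‹_›) (mul_le_mul_of_nonneg_left (Finset.sum_le_sum
    fun u _ => Finset.sum_le_sum fun v _ => mul_le_mul_of_nonneg_left (h2 u v)
      (mul_nonneg (hw _) (hw _))) ‹_›)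

theorem avg_le_avg {p : ℝ} (hp : p ∈ Set.Icc (0 : ℝ) 1) {h h' : Multigraph → ℝ} {G : Multigraph}
    (h1 : ∀ u, h (G.addVertex u) ≤ h' (G.addVertex u))
    (h2 : ∀ u v, h (G.addEdge u v) ≤ h' (G.addEdge u v)) : avg p h G ≤ avg p h' G :=
  avg_le hp h1 h2

/-- A time-dependent property of multigraphs that is kept by every possible step. -/
def Preserved (I : ℕ → Multigraph → Prop) : Prop :=
  ∀ t G, I t G → (∀ u, I (t + 1) (G.addVertex u)) ∧ ∀ u v, I (t + 1) (G.addEdge u v)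

theorem Preserved.and {I J : ℕ → Multigraph → Prop} (hI : Preserved I) (hJ : Preserved J) :
    Preserved fun t G => I t G ∧ J t G := fun t G h =>
  ⟨fun u => ⟨(hI t G h.1).1 u, (hJ t G h.2).1 u⟩, fun u v => ⟨(hI t G h.1).2 u v,
    (hJ t G h.2).2 u v⟩⟩

section ev

variable {f : ℝ → unitInterval}

/-- The operator peels off the last step, so the induction passes from the functions to their
averages. A preserved property is all that needs to be known about the graphs reachable from `H`. -/
theorem ev_mono {I : ℕ → Multigraph → Prop} (hI : Preserved I) {s k : ℕ} {h h' : Multigraph → ℝ}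
    (hh : ∀ G, I (s + k) G → h G ≤ h' G) {H : Multigraph} (hH : I s H) :
    ev f s k h H ≤ ev f s k h' H := by
  induction k generalizing h h' with
  | zero => exact hh H hH
  | succ k ih =>
    refine ih fun G hG => avg_le_avg (f _).2 ?_ ?_
    · exact fun u => hh _ ((hI _ _ hG).1 u)
    · exact fun u v => hh _ ((hI _ _ hG).2 u v)

theorem ev_nonneg {s k : ℕ} {h : Multigraph → ℝ} (hh : ∀ G, 0 ≤ h G) (H : Multigraph) :
    0 ≤ ev f s k h H := by
  induction k generalizing h with
  | zero => exact hh H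
  | succ k ih => exact ih (avg_nonneg (f _).2 hh)

theorem ev_const (s k : ℕ) (c : ℝ) : ev f s k (fun _ => c) = fun _ => c := by
  induction k with
  | zero => rfl
  | succ k ih => rw [ev, avg_const, ih]

theorem ev_add_fun (s k : ℕ) (h h' : Multigraph → ℝ) :
    ev f s k (fun G => h G + h' G) = fun G => ev f s k h G + ev f s k h' G := by
  induction k generalizing h h' with
  | zero => rfl
  | succ k ih => simp only [ev, avg_add, ih]

theorem ev_mul_left (s k : ℕ) (c : ℝ) (h : Multigraph → ℝ) :
    ev f s k (fun G => c * h G) = fun G => c * ev f s k h G := by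
  induction k generalizing h with
  | zero => rfl
  | succ k ih => simp only [ev, avg_mul_left, ih]

theorem ev_sum {ι : Type*} (s k : ℕ) (S : Finset ι) (h : ι → Multigraph → ℝ) :
    ev f s k (fun G => ∑ i ∈ S, h i G) = fun G => ∑ i ∈ S, ev f s k (h i) G := by
  classical
  induction S using Finset.induction_on with
  | empty => simpa using ev_const s k 0
  | insert a S ha ih => simp only [Finset.sum_insert ha, ev_add_fun, ih]

/-- The Markov property: the later phase is estimated conditionally on the graph at time `s + k`,
and the result is then averaged. -/
theorem ev_comp (s k l : ℕ) (h : Multigraph → ℝ) :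
    ev f s (k + l) h = ev f s k (ev f (s + k) l h) := by
  induction l generalizing h with
  | zero => rfl
  | succ l ih => rw [← add_assoc, ev, ih, ev, add_assoc]

/-- Supermartingale bound. -/
theorem ev_le_of_step {I : ℕ → Multigraph → Prop} (hI : Preserved I) {s k : ℕ}
    (h : ℕ → Multigraph → ℝ)
    (hstep : ∀ j < k, ∀ G, I (s + j) G →
      avg (f (((s + j : ℕ) : ℝ) + 1)) (h (j + 1)) G ≤ h j G) {H : Multigraph} (hH : I s H) :
    ev f s k (h k) H ≤ h 0 H := by
  induction k with
  | zero => exact le_rfl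
  | succ k ih =>
    exact (ev_mono hI (hstep k k.lt_succ_self) hH).trans
      (ih fun j hj => hstep j (hj.trans k.lt_succ_self))

end ev

/-! ### From the law of the process to the backward operator. -/

theorem tsum_bind_mul {α β : Type*} (p : PMF α) (k : α → PMF β) (h : β → ENNReal) :
    ∑' b, p.bind k b * h b = ∑' a, p a * ∑' b, k a b * h b := by
  simp only [PMF.bind_apply, ← ENNReal.tsum_mul_right, ← ENNReal.tsum_mul_left, mul_assoc]
  exact ENNReal.tsum_comm

theorem tsum_pure_mul {α : Type*} (a : α) (h : α → ENNReal) :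
    ∑' b, PMF.pure a b * h b = h a := by
  classical
  rw [tsum_eq_single a fun b hb => by simp [PMF.pure_apply, hb]]
  simp

theorem tsum_step_mul (p : unitInterval) (G : Multigraph) {h : Multigraph → ℝ}
    (hh : ∀ G, 0 ≤ h G) :
    ∑' G', step p G G' * ENNReal.ofReal (h G') = ENNReal.ofReal (avg p h G) := by
  have hw := G.weight_nonneg
  have h1 : 0 ≤ ∑ u : Fin G.order, G.weight u * h (G.addVertex u) :=
    Finset.sum_nonneg fun u _ => mul_nonneg (hw _) (hh _)
  have h2 : 0 ≤ ∑ u : Fin G.order, ∑ v : Fin G.order,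
      G.weight u * G.weight v * h (G.addEdge u v) :=
    Finset.sum_nonneg fun u _ => Finset.sum_nonneg fun v _ =>
      mul_nonneg (mul_nonneg (hw _) (hw _)) (hh _)
  have hp := p.2.1
  have hp' := sub_nonneg.2 p.2.2
  have e1 : ∑' G', G.vertexOperation G' * ENNReal.ofReal (h G') =
      ENNReal.ofReal (∑ u : Fin G.order, G.weight u * h (G.addVertex u)) := by
    rw [vertexOperation, tsum_bind_mul]
    simp only [tsum_pure_mul, tsum_fintype, pi_apply]
    rw [ENNReal.ofReal_sum_of_nonneg fun u _ => mul_nonneg (hw _) (hh _)]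
    exact Finset.sum_congr rfl fun u _ => (ENNReal.ofReal_mul (hw _)).symm
  have e2 : ∑' G', G.edgeOperation G' * ENNReal.ofReal (h G') =
      ENNReal.ofReal (∑ u : Fin G.order, ∑ v : Fin G.order,
        G.weight u * G.weight v * h (G.addEdge u v)) := by
    rw [edgeOperation, tsum_bind_mul]
    simp only [tsum_bind_mul, tsum_pure_mul, tsum_fintype, pi_apply]
    rw [ENNReal.ofReal_sum_of_nonneg fun u _ => Finset.sum_nonneg fun v _ =>
      mul_nonneg (mul_nonneg (hw _) (hw _)) (hh _)]
    refine Finset.sum_congr rfl fun u _ => ?_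
    rw [ENNReal.ofReal_sum_of_nonneg fun v _ => mul_nonneg (mul_nonneg (hw _) (hw _)) (hh _),
      Finset.mul_sum]
    refine Finset.sum_congr rfl fun v _ => ?_
    rw [mul_assoc, ENNReal.ofReal_mul (hw _), ENNReal.ofReal_mul (hw _)]
  rw [step, tsum_bind_mul, tsum_fintype, Fintype.sum_bool]
  simp only [coin, PMF.ofFintype_apply, cond_true, cond_false]
  rw [e1, e2, avg, ENNReal.ofReal_add (mul_nonneg hp h1) (mul_nonneg hp' h2),
    ENNReal.ofReal_mul hp, ENNReal.ofReal_mul hp']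

/-- The law is built forwards by `bind` and `ev` backwards by averaging; integrating the last step
first identifies them. From here on only real finite sums occur. -/
theorem tsum_graphLaw_mul (f : ℝ → unitInterval) (t : ℕ) {h : Multigraph → ℝ}
    (hh : ∀ G, 0 ≤ h G) :
    ∑' G, graphLaw f t G * ENNReal.ofReal (h G) = ENNReal.ofReal (ev f 0 t h initialGraph) := by
  induction t generalizing h with
  | zero => rw [graphLaw, tsum_pure_mul, ev]
  | succ t ih =>
    rw [graphLaw, tsum_bind_mul]
    simp only [tsum_step_mul _ _ hh]
    rw [ih (avg_nonneg (f _).2 hh), ev, zero_add]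

open Classical in
/-- The indicator of a proposition. -/
noncomputable def indic (P : Prop) : ℝ := if P then 1 else 0

theorem indic_le {P : Prop} {b : ℝ} (hb : 0 ≤ b) (h : P → 1 ≤ b) : indic P ≤ b := by
  unfold indic; split_ifs with hP
  · exact h hP
  · exact hb

theorem indic_nonneg (P : Prop) : 0 ≤ indic P := by unfold indic; split_ifs <;> norm_num

theorem indic_of {P : Prop} (h : P) : indic P = 1 := if_pos h

theorem indic_not {P : Prop} (h : ¬P) : indic P = 0 := if_neg h

theorem indic_le_one (P : Prop) : indic P ≤ 1 := indic_le zero_le_one fun _ => le_rfl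

theorem graphLaw_real_eq (f : ℝ → unitInterval) (t : ℕ) (A : Set Multigraph) :
    (graphLaw f t).toMeasure.real A = ev f 0 t (fun G => indic (G ∈ A)) initialGraph := by
  have h := tsum_graphLaw_mul f t (h := fun G => indic (G ∈ A)) (fun G => indic_nonneg _)
  have h0 : 0 ≤ ev f 0 t (fun G => indic (G ∈ A)) initialGraph :=
    ev_nonneg (fun G => indic_nonneg _) _
  rw [MeasureTheory.measureReal_def, PMF.toMeasure_apply_eq_tsum, ← ENNReal.toReal_ofReal h0, ← h]
  congr 2
  funext G
  by_cases hG : G ∈ A <;> simp [indic, hG]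

/-! ### Deterministic invariants. -/

/-- The deterministic properties of the graph at time `t`. -/
def Inv (t : ℕ) (G : Multigraph) : Prop :=
  G.edges.card = t + 1 ∧ ∀ n < G.order, 1 ≤ G.deg n

theorem preserved_inv : Preserved Inv := by
  intro t G hG
  refine ⟨fun u => ⟨by rw [card_addVertex, hG.1], fun n hn => ?_⟩,
    fun u v => ⟨by rw [card_addEdge, hG.1], fun n hn => ?_⟩⟩
  · rw [deg_addVertex]
    rcases Nat.lt_succ_iff_lt_or_eq.1 hn with h | h
    · have := hG.2 n h
      omega
    · rw [if_pos h.symm]; omega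
  · rw [deg_addEdge]
    have := hG.2 n hn
    omega

theorem natEdges_initialGraph : initialGraph.natEdges = {s(0, 0)} := rfl

theorem inv_initialGraph : Inv 0 initialGraph := by
  refine ⟨rfl, fun n hn => ?_⟩
  have : n = 0 := by
    have : n < 1 := hn
    omega
  subst this
  rw [deg, natEdges_initialGraph, Multiset.map_singleton, Multiset.sum_singleton,
    count_toMultiset_mk]
  simp

theorem preserved_lt_order (n : ℕ) : Preserved fun _ G => n < G.order := fun _ _ h =>
  ⟨fun _ => Nat.lt_succ_of_lt h, fun _ _ => h⟩

theorem preserved_le_deg (n : ℕ) (x : ℝ) : Preserved fun _ G => x ≤ G.deg n := fun _ G h => by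
  refine ⟨fun u => h.trans ?_, fun u v => h.trans ?_⟩
  · rw [deg_addVertex]; exact_mod_cast Nat.le_add_right _ _
  · rw [deg_addEdge]; exact_mod_cast Nat.le_add_right _ _

end EdgeStep

/-! ### One-step drift of a negative power of a degree. -/

namespace EdgeStep

open Multigraph Finset

/-- The indicator of the event that the vertex `u` has label `i`. -/
def hit (i u : ℕ) : ℝ := if u = i then 1 else 0

theorem hit_nonneg (i u : ℕ) : 0 ≤ hit i u := by unfold hit; split_ifs <;> norm_num

theorem hit_mul_of_ne {i j : ℕ} (h : i ≠ j) (u : ℕ) : hit i u * hit j u = 0 := by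
  unfold hit
  split_ifs with h1 h2
  · exact absurd (h1.symm.trans h2) h
  all_goals norm_num

theorem sum_weight_mul_hit (G : Multigraph) (i : ℕ) :
    ∑ u : Fin G.order, G.weight u * hit i u = G.weight i := by
  simp only [hit, mul_ite, mul_one, mul_zero]
  by_cases hi : i < G.order
  · rw [Finset.sum_eq_single (⟨i, hi⟩ : Fin G.order)]
    · simp
    · intro b _ hb
      rw [if_neg]
      exact fun h => hb (Fin.ext h)
    · simp
  · have : G.weight i = 0 := by
      rw [weight, G.deg_eq_zero (not_lt.1 hi)]; simp
    rw [this]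
    refine Finset.sum_eq_zero fun u _ => if_neg ?_
    have := u.2
    omega

theorem sum_weight_affine (G : Multigraph) (i : ℕ) (c₀ c₁ : ℝ) :
    ∑ u : Fin G.order, G.weight u * (c₀ + c₁ * hit i u) = c₀ + c₁ * G.weight i := by
  simp only [mul_add, Finset.sum_add_distrib, ← Finset.sum_mul, sum_weight, mul_left_comm _ c₁,
    ← Finset.mul_sum, sum_weight_mul_hit, one_mul]

theorem sum_weight_affine₂ (G : Multigraph) (i j : ℕ) (c₀ c₁ c₂ : ℝ) :
    ∑ u : Fin G.order, G.weight u * (c₀ + c₁ * hit i u + c₂ * hit j u) =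
      c₀ + c₁ * G.weight i + c₂ * G.weight j := by
  have h : ∀ u : Fin G.order, G.weight u * (c₀ + c₁ * hit i u + c₂ * hit j u) =
      G.weight u * (c₀ + c₁ * hit i u) + G.weight u * (0 + c₂ * hit j u) := fun u => by ring
  simp only [h, Finset.sum_add_distrib, sum_weight_affine]
  ring

/-- The two ends are independent, so products of hits average to products of weights. The
edge-operation estimates below are brought to this form, with zero coefficients for absent terms; `i
= j` is allowed. -/
theorem sum_sum_weight_bilinear (G : Multigraph) (i j : ℕ) (c₀ c₁ c₂ c₃ c₄ : ℝ) :
    ∑ u : Fin G.order, ∑ v : Fin G.order, G.weight u * G.weight v *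
      (c₀ + c₁ * (hit i u + hit i v) + c₂ * (hit j u + hit j v) + c₃ * (hit i u * hit j v) +
        c₄ * (hit j u * hit i v)) =
      c₀ + 2 * c₁ * G.weight i + 2 * c₂ * G.weight j + (c₃ + c₄) * (G.weight i * G.weight j) := by
  have h : ∀ u v : Fin G.order, G.weight u * G.weight v *
      (c₀ + c₁ * (hit i u + hit i v) + c₂ * (hit j u + hit j v) + c₃ * (hit i u * hit j v) +
        c₄ * (hit j u * hit i v)) = G.weight u * (G.weight v *
        ((c₀ + c₁ * hit i u + c₂ * hit j u) + (c₁ + c₄ * hit j u) * hit i v +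
          (c₂ + c₃ * hit i u) * hit j v)) := fun u v => by ring
  simp only [h, ← Finset.mul_sum, sum_weight_affine₂]
  have h' : ∀ u : Fin G.order, G.weight u * (c₀ + c₁ * hit i u + c₂ * hit j u +
      (c₁ + c₄ * hit j u) * G.weight i + (c₂ + c₃ * hit i u) * G.weight j) = G.weight u *
      ((c₀ + c₁ * G.weight i + c₂ * G.weight j) + (c₁ + c₃ * G.weight j) * hit i u +
        (c₂ + c₄ * G.weight i) * hit j u) := fun u => by ring
  simp only [h', sum_weight_affine₂]
  ring

theorem deg_addVertex_of_lt (G : Multigraph) (u : Fin G.order) {i : ℕ} (hi : i < G.order) :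
    ((G.addVertex u).deg i : ℝ) = G.deg i + hit i u := by
  rw [deg_addVertex, if_neg hi.ne', add_zero, Nat.cast_add, hit]
  push_cast
  rfl

theorem deg_addVertex_order (G : Multigraph) (u : Fin G.order) :
    (G.addVertex u).deg G.order = 1 := by
  rw [deg_addVertex, G.deg_eq_zero le_rfl, if_neg u.2.ne, if_pos rfl]

theorem deg_addEdge_cast (G : Multigraph) (u v : Fin G.order) (i : ℕ) :
    ((G.addEdge u v).deg i : ℝ) = G.deg i + (hit i u + hit i v) := by
  rw [deg_addEdge, hit, hit]
  push_cast
  rfl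

/-- The function `d ↦ Γ(d) / Γ(d + τ)` on positive integers, up to a constant factor. -/
noncomputable def decay (τ : ℝ) : ℕ → ℝ
  | 0 => 1
  | 1 => 1
  | d + 2 => decay τ (d + 1) * ((d + 1) / (d + 1 + τ))

theorem decay_succ (τ : ℝ) {d : ℕ} (hd : 1 ≤ d) :
    decay τ (d + 1) = decay τ d * (d / (d + τ)) := by
  obtain ⟨d, rfl⟩ := Nat.exists_eq_add_of_le' hd
  rw [decay]; push_cast; rfl

theorem decay_pos {τ : ℝ} (hτ : 0 ≤ τ) : ∀ d, 0 < decay τ d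
  | 0 => one_pos
  | 1 => one_pos
  | d + 2 => by
    rw [decay]
    exact mul_pos (decay_pos hτ (d + 1)) (by positivity)

theorem decay_le_one {τ : ℝ} (hτ : 0 ≤ τ) : ∀ d, decay τ d ≤ 1
  | 0 => le_rfl
  | 1 => le_rfl
  | d + 2 => by
    rw [decay]
    refine mul_le_one₀ (decay_le_one hτ (d + 1)) (by positivity) ?_
    rw [div_le_one (by positivity)]
    linarith

/-- Passing from `d` to `d + 1` multiplies the right side by at least exp(-τ/(d+1)), by 1 + z ≤ exp
z, and the power on the left by at most that, since log(d+1) - log d ≥ 1/(d+1). Shifting the index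
of `decay` by one makes both rates equal. -/
theorem le_decay_succ {τ : ℝ} (hτ : 0 ≤ τ) {d : ℕ} (hd : 1 ≤ d) :
    Real.exp (-τ) * (d : ℝ) ^ (-τ) ≤ decay τ (d + 1) := by
  induction d, hd using Nat.le_induction with
  | base =>
    rw [decay_succ τ le_rfl, decay]
    have h : 0 < 1 + τ := by positivity
    have := Real.add_one_le_exp τ
    simp only [Nat.cast_one, Real.one_rpow, mul_one, one_mul]
    rw [Real.exp_neg, inv_eq_one_div]
    exact one_div_le_one_div_of_le h (by linarith)
  | succ d hd ih =>
    have hd0 : (0 : ℝ) < d := by exact_mod_cast hd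
    rw [decay_succ τ (Nat.le_add_left 1 d)]
    have h1 : Real.exp (-τ / (d + 1)) ≤ ((d + 1 : ℕ) : ℝ) / ((d + 1 : ℕ) + τ) := by
      push_cast
      have := Real.add_one_le_exp (τ / (d + 1 : ℝ))
      have e : ((d : ℝ) + 1) / (d + 1 + τ) = 1 / (τ / (d + 1) + 1) := by field_simp; ring
      rw [e, neg_div, Real.exp_neg, inv_eq_one_div]
      exact one_div_le_one_div_of_le (by positivity) this
    have h2 : ((d + 1 : ℕ) : ℝ) ^ (-τ) ≤ (d : ℝ) ^ (-τ) * Real.exp (-τ / (d + 1)) := by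
      have hlog : 1 / ((d : ℝ) + 1) ≤ Real.log (d + 1) - Real.log d := by
        rw [← Real.log_div (by positivity) hd0.ne']
        have := Real.one_sub_inv_le_log_of_pos (x := ((d : ℝ) + 1) / d) (by positivity)
        refine le_trans (le_of_eq ?_) this
        field_simp
        ring
      push_cast
      rw [Real.rpow_def_of_pos (by positivity), Real.rpow_def_of_pos hd0, ← Real.exp_add]
      refine Real.exp_le_exp.2 ?_
      have := mul_le_mul_of_nonneg_left hlog hτ
      rw [neg_div, div_eq_mul_one_div τ]
      linarith
    calc Real.exp (-τ) * ((d + 1 : ℕ) : ℝ) ^ (-τ)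
        ≤ Real.exp (-τ) * ((d : ℝ) ^ (-τ) * Real.exp (-τ / (d + 1))) := by gcongr
      _ = (Real.exp (-τ) * (d : ℝ) ^ (-τ)) * Real.exp (-τ / (d + 1)) := by ring
      _ ≤ _ := mul_le_mul ih h1 (Real.exp_pos _).le (decay_pos hτ _).le

theorem le_decay {τ : ℝ} (hτ : 0 ≤ τ) {d : ℕ} (hd : 1 ≤ d) :
    Real.exp (-τ) * (d : ℝ) ^ (-τ) ≤ decay τ d := by
  rcases hd.eq_or_lt with rfl | h
  · simp [decay, hτ]
  · obtain ⟨e, rfl⟩ := Nat.exists_eq_add_of_le' hd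
    have he : 1 ≤ e := by omega
    refine le_trans ?_ (le_decay_succ hτ he)
    gcongr ?_ * ?_
    refine Real.rpow_le_rpow_of_nonpos (by exact_mod_cast he) ?_ (by linarith)
    push_cast; linarith

/-- Each hit of `i` lowers `decay` by the relative amount τ/(d+τ), while an end hits `i` with
probability d/(2n), n being the number of edges. Their product is nearly independent of d.
Vertex-operations offer only one end for a hit, which costs the p/2; double hits cost the 1/(2n). -/
theorem avg_decay_le {p τ : ℝ} (hp : p ∈ Set.Icc (0 : ℝ) 1) (hτ : 0 < τ) (hτ' : τ ≤ 1)
    {G : Multigraph} {i : ℕ} (hi : i < G.order) (hd : 1 ≤ G.deg i) :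
    avg p (fun G => decay τ (G.deg i)) G ≤
      (1 - τ / (1 + τ) * (1 - (p + 1 / G.edges.card) / 2) / G.edges.card) *
        decay τ (G.deg i) := by
  obtain ⟨hp0, hp1⟩ := hp
  set g := decay τ (G.deg i) with hg
  set d : ℝ := (G.deg i : ℝ) with hdd
  set n : ℝ := (G.edges.card : ℝ) with hn
  have hn1 : 1 ≤ n := by
    have := Multiset.card_pos.2 G.edges_ne_zero
    rw [hn]; exact_mod_cast this
  have hd1 : 1 ≤ d := by rw [hdd]; exact_mod_cast hd
  set x₁ := τ / (d + τ) with hx₁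
  set x₂ := τ / (d + 1 + τ) with hx₂
  have e1 : decay τ (G.deg i + 1) = g * (1 - x₁) := by
    rw [decay_succ τ hd, hx₁]
    congr 1
    rw [eq_sub_iff_add_eq, ← hdd]
    field_simp
  have e2 : decay τ (G.deg i + 2) = g * (1 - x₁) * (1 - x₂) := by
    rw [decay_succ τ (by omega), e1, hx₂]
    congr 1
    push_cast
    rw [eq_sub_iff_add_eq, ← hdd]
    field_simp
  have key := avg_le ⟨hp0, hp1⟩ (h := fun G => decay τ (G.deg i)) (G := G)
    (φ := fun u => g + (-(g * x₁)) * hit i u)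
    (ψ := fun u v => g + (-(g * x₁)) * (hit i u + hit i v) + 0 * (hit i u + hit i v) +
      (g * (x₁ - x₂ + x₁ * x₂)) * (hit i u * hit i v) + 0 * (hit i u * hit i v))
    (fun u => by
      simp only [deg_addVertex, if_neg hi.ne', add_zero, hit]
      split_ifs
      · rw [e1]; apply le_of_eq; ring
      · simp [hg])
    (fun u v => by
      simp only [deg_addEdge, hit]
      split_ifs
      · rw [e2]; apply le_of_eq; ring
      · rw [add_zero, e1]; apply le_of_eq; ring
      · rw [zero_add, e1]; apply le_of_eq; ring
      · simp [hg])
  rw [sum_weight_affine, sum_sum_weight_bilinear] at key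
  refine key.trans ?_
  have hw : G.weight i = d / (2 * n) := rfl
  rw [hw]
  have hg0 : 0 ≤ g := (decay_pos hτ.le _).le
  set w := d / (2 * n) with hww
  have hw0 : 0 ≤ w := by positivity
  have hx0 : 0 ≤ x₁ := by positivity
  -- A loop at `i` lowers `decay` by less than twice the effect of one hit; this correction is of
  -- lower order in `1 / n`.
  have c1 : w * (x₁ - x₂ + x₁ * x₂) ≤ x₁ / n := by
    have : w * (x₁ - x₂ + x₁ * x₂) = x₁ / n * (d * (1 + τ) / (2 * (d + 1 + τ))) := by
      rw [hww, hx₁, hx₂]; field_simp; ring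
    rw [this]
    refine mul_le_of_le_one_right (by positivity) ?_
    rw [div_le_one (by positivity)]
    nlinarith
  -- The factor d/(d+τ) is smallest at degree one.
  have c2 : τ / (1 + τ) / (2 * n) ≤ w * x₁ := by
    have : w * x₁ = (d * τ / (d + τ)) / (2 * n) := by rw [hww, hx₁]; field_simp
    rw [this]
    refine div_le_div_of_nonneg_right ?_ (by positivity)
    rw [div_le_div_iff₀ (by positivity) (by positivity)]
    nlinarith [mul_nonneg (sq_nonneg τ) (sub_nonneg.2 hd1)]
  have hn' : 1 / n ≤ 1 := by rw [div_le_one (by positivity)]; exact hn1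
  have c3 : τ / (1 + τ) / (2 * n) * (2 - p - 1 / n) ≤ w * x₁ * (2 - p - 1 / n) :=
    mul_le_mul_of_nonneg_right c2 (by linarith)
  have c4 : w * (w * (x₁ - x₂ + x₁ * x₂)) ≤ w * (x₁ / n) := mul_le_mul_of_nonneg_left c1 hw0
  have c5 : (1 - p) * (w * (w * (x₁ - x₂ + x₁ * x₂))) ≤ (1 - p) * (w * (x₁ / n)) :=
    mul_le_mul_of_nonneg_left c4 (by linarith)
  have c6 : (1 - p) * (w * (x₁ / n)) ≤ w * x₁ * (1 / n) := by
    have : 0 ≤ w * (x₁ / n) := by positivity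
    have e : w * x₁ * (1 / n) = w * (x₁ / n) := by ring
    rw [e]; nlinarith
  have c7 : τ / (1 + τ) * (1 - (p + 1 / n) / 2) / n =
      τ / (1 + τ) / (2 * n) * (2 - p - 1 / n) := by
    field_simp
    ring
  rw [c7]
  have : p * (g + -(g * x₁) * w) + (1 - p) * (g + 2 * -(g * x₁) * w + 2 * 0 * w +
      (g * (x₁ - x₂ + x₁ * x₂) + 0) * (w * w)) = (1 - (w * x₁ * (2 - p) -
        (1 - p) * (w * (w * (x₁ - x₂ + x₁ * x₂))))) * g := by ring
  rw [this]
  refine mul_le_mul_of_nonneg_right ?_ hg0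
  linarith

end EdgeStep

/-! ### One-step drift of degree powers and of links. -/

namespace EdgeStep

open Multigraph Finset

/-- The degree of the vertex with label `i`, raised to the power `θ`. -/
noncomputable def degPow (θ : ℝ) (i : ℕ) (G : Multigraph) : ℝ := (G.deg i : ℝ) ^ θ

open Classical in
/-- The indicator of the event that `i` and `j` are joined by an edge. -/
noncomputable def link (i j : ℕ) (G : Multigraph) : ℝ := if s(i, j) ∈ G.natEdges then 1 else 0

theorem degPow_nonneg (θ : ℝ) (i : ℕ) (G : Multigraph) : 0 ≤ degPow θ i G := by
  unfold degPow; positivity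

theorem link_mem (i j : ℕ) (G : Multigraph) : 0 ≤ link i j G ∧ link i j G ≤ 1 := by
  unfold link; split_ifs <;> norm_num

theorem link_comm (i j : ℕ) (G : Multigraph) : link i j G = link j i G := by
  rw [link, link, Sym2.eq_swap]

theorem link_eq (i j : ℕ) (G : Multigraph) : link i j G = 0 ∨ link i j G = 1 := by
  unfold link; split_ifs <;> simp

theorem link_addVertex (G : Multigraph) (u : Fin G.order) {i j : ℕ} (hi : i < G.order)
    (hj : j < G.order) : link i j (G.addVertex u) = link i j G := by
  have : s(i, j) ≠ s((u : ℕ), G.order) := by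
    rw [Ne, Sym2.eq_iff]
    omega
  simp only [link, natEdges_addVertex, Multiset.mem_cons, this, false_or]

theorem link_addVertex_order (G : Multigraph) (u : Fin G.order) {i : ℕ} (hi : i < G.order) :
    link i G.order (G.addVertex u) = hit i u := by
  have h1 : s(i, G.order) ∉ G.natEdges := fun h => (G.lt_order_of_mem h).2.ne rfl
  have h2 : s(i, G.order) = s((u : ℕ), G.order) ↔ (u : ℕ) = i := by
    rw [Sym2.eq_iff]
    omega
  simp only [link, natEdges_addVertex, Multiset.mem_cons, h1, or_false, h2, hit]

theorem link_addEdge (G : Multigraph) (u v : Fin G.order) {i j : ℕ} (hij : i ≠ j) :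
    link i j (G.addEdge u v) =
      link i j G + (1 - link i j G) * (hit i u * hit j v + hit j u * hit i v) := by
  have h2 : s(i, j) = s((u : ℕ), (v : ℕ)) ↔ (u = i ∧ v = j) ∨ (u = j ∧ (v : ℕ) = i) := by
    rw [Sym2.eq_iff]
    omega
  by_cases h : s(i, j) ∈ G.natEdges
  · simp [link, natEdges_addEdge, h]
  · simp only [link, natEdges_addEdge, Multiset.mem_cons, h, or_false, h2, hit, if_false]
    by_cases h3 : (u : ℕ) = i <;> by_cases h4 : (v : ℕ) = j <;> by_cases h5 : (u : ℕ) = j <;>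
      by_cases h6 : (v : ℕ) = i <;> simp [h3, h4, h5, h6] <;> omega

theorem rpow_add_le {θ : ℝ} (h0 : 0 ≤ θ) (h1 : θ ≤ 1) {d k : ℝ} (hd : 1 ≤ d) (hk : 0 ≤ k) :
    (d + k) ^ θ ≤ d ^ θ * (1 + θ * (k / d)) := by
  have hd0 : 0 < d := by linarith
  have e : d + k = d * (1 + k / d) := by field_simp
  rw [e, Real.mul_rpow hd0.le (by positivity)]
  refine mul_le_mul_of_nonneg_left ?_ (by positivity)
  have : 0 ≤ k / d := by positivity
  exact rpow_one_add_le_one_add_mul_self (by linarith) h0 h1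

section

variable {p θ : ℝ} {G : Multigraph} {i j : ℕ}

theorem one_le_card (G : Multigraph) : (1 : ℝ) ≤ G.edges.card := by
  have := Multiset.card_pos.2 G.edges_ne_zero
  exact_mod_cast this

theorem degPow_addVertex_le (h0 : 0 ≤ θ) (h1 : θ ≤ 1) (hi : i < G.order) (hd : 1 ≤ G.deg i)
    (u : Fin G.order) :
    degPow θ i (G.addVertex u) ≤ degPow θ i G * (1 + θ / G.deg i * hit i u) := by
  rw [degPow, deg_addVertex_of_lt G u hi, degPow]
  refine (rpow_add_le h0 h1 (by exact_mod_cast hd) (hit_nonneg _ _)).trans (le_of_eq ?_)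
  ring

theorem degPow_addVertex_order (u : Fin G.order) : degPow θ G.order (G.addVertex u) = 1 := by
  rw [degPow, deg_addVertex_order]
  simp

theorem degPow_addEdge_le (h0 : 0 ≤ θ) (h1 : θ ≤ 1) (hd : 1 ≤ G.deg i) (u v : Fin G.order) :
    degPow θ i (G.addEdge u v) ≤ degPow θ i G * (1 + θ / G.deg i * (hit i u + hit i v)) := by
  rw [degPow, deg_addEdge_cast G u v, degPow]
  refine (rpow_add_le h0 h1 (by exact_mod_cast hd)
    (add_nonneg (hit_nonneg _ _) (hit_nonneg _ _))).trans (le_of_eq ?_)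
  ring

/-- Preferential attachment cancels the degree: the relative growth rate of a degree power is the
same for all vertices. -/
theorem div_deg_mul_weight (hd : 1 ≤ G.deg i) :
    θ / G.deg i * G.weight i = θ / (2 * G.edges.card) := by
  have := one_le_card G
  have hd0 : (0 : ℝ) < G.deg i := by exact_mod_cast hd
  rw [weight]
  field_simp

theorem convex_comb_le {p x y z : ℝ} (hp : p ∈ Set.Icc (0 : ℝ) 1) (hx : x ≤ z) (hy : y ≤ z) :
    p * x + (1 - p) * y ≤ z := by
  nlinarith [mul_le_mul_of_nonneg_left hx hp.1, mul_le_mul_of_nonneg_left hy (sub_nonneg.2 hp.2)]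

theorem avg_degPow_le (hp : p ∈ Set.Icc (0 : ℝ) 1) (h0 : 0 ≤ θ) (h1 : θ ≤ 1) (hi : i < G.order)
    (hd : 1 ≤ G.deg i) :
    avg p (degPow θ i) G ≤ degPow θ i G * (1 + θ / G.edges.card) := by
  have hn := one_le_card G
  have key := avg_le hp (h := degPow θ i) (G := G)
    (φ := fun u => degPow θ i G + (degPow θ i G * (θ / G.deg i)) * hit i u)
    (ψ := fun u v => degPow θ i G + (degPow θ i G * (θ / G.deg i)) * (hit i u + hit i v) +
      0 * (hit i u + hit i v) + 0 * (hit i u * hit i v) + 0 * (hit i u * hit i v))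
    (fun u => (degPow_addVertex_le h0 h1 hi hd u).trans (le_of_eq (by ring)))
    (fun u v => (degPow_addEdge_le h0 h1 hd u v).trans (le_of_eq (by ring)))
  rw [sum_weight_affine, sum_sum_weight_bilinear] at key
  have e := div_deg_mul_weight (θ := θ) hd
  have ha := degPow_nonneg θ i G
  refine key.trans (convex_comb_le hp ?_ (le_of_eq ?_))
  · rw [mul_assoc (degPow θ i G), e, mul_add, mul_one]
    gcongr
    linarith
  · have : degPow θ i G + 2 * (degPow θ i G * (θ / G.deg i)) * G.weight i + 2 * 0 * G.weight i +
      (0 + 0) * (G.weight i * G.weight i) =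
      degPow θ i G + 2 * degPow θ i G * (θ / G.deg i * G.weight i) := by ring
    rw [this, e]
    field_simp

theorem degPow_mul_addVertex_le (h0 : 0 ≤ θ) (h1 : θ ≤ 1) (hi : i < G.order) (hj : j < G.order)
    (hij : i ≠ j) (hdi : 1 ≤ G.deg i) (hdj : 1 ≤ G.deg j) (u : Fin G.order) :
    degPow θ i (G.addVertex u) * degPow θ j (G.addVertex u) ≤ degPow θ i G * degPow θ j G *
      (1 + θ / G.deg i * hit i u + θ / G.deg j * hit j u) := by
  refine (mul_le_mul (degPow_addVertex_le h0 h1 hi hdi u) (degPow_addVertex_le h0 h1 hj hdj u)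
    (degPow_nonneg _ _ _) (mul_nonneg (degPow_nonneg _ _ _) ?_)).trans (le_of_eq ?_)
  · have := hit_nonneg i u
    positivity
  · have := hit_mul_of_ne hij u
    linear_combination (degPow θ i G * degPow θ j G * (θ / G.deg i) * (θ / G.deg j)) * this

theorem degPow_mul_addEdge_le (h0 : 0 ≤ θ) (h1 : θ ≤ 1) (hij : i ≠ j)
    (hdi : 1 ≤ G.deg i) (hdj : 1 ≤ G.deg j) (u v : Fin G.order) :
    degPow θ i (G.addEdge u v) * degPow θ j (G.addEdge u v) ≤ degPow θ i G * degPow θ j G *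
      (1 + θ / G.deg i * (hit i u + hit i v) + θ / G.deg j * (hit j u + hit j v) +
        θ / G.deg i * (θ / G.deg j) * (hit i u * hit j v) +
        θ / G.deg i * (θ / G.deg j) * (hit j u * hit i v)) := by
  refine (mul_le_mul (degPow_addEdge_le h0 h1 hdi u v) (degPow_addEdge_le h0 h1 hdj u v)
    (degPow_nonneg _ _ _) (mul_nonneg (degPow_nonneg _ _ _) ?_)).trans (le_of_eq ?_)
  · have := hit_nonneg i u
    have := hit_nonneg i v
    positivity
  · have h1 := hit_mul_of_ne hij u
    have h2 := hit_mul_of_ne hij v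
    linear_combination (degPow θ i G * degPow θ j G * (θ / G.deg i) * (θ / G.deg j)) * (h1 + h2)

theorem avg_degPow_mul_le (hp : p ∈ Set.Icc (0 : ℝ) 1) (h0 : 0 ≤ θ) (h1 : θ ≤ 1)
    (hi : i < G.order) (hj : j < G.order) (hij : i ≠ j) (hdi : 1 ≤ G.deg i) (hdj : 1 ≤ G.deg j) :
    avg p (fun G => degPow θ i G * degPow θ j G) G ≤
      degPow θ i G * degPow θ j G * (1 + θ / G.edges.card) ^ 2 := by
  have hn := one_le_card G
  set P := degPow θ i G * degPow θ j G with hP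
  have hP0 : 0 ≤ P := mul_nonneg (degPow_nonneg _ _ _) (degPow_nonneg _ _ _)
  have key := avg_le hp (h := fun G => degPow θ i G * degPow θ j G) (G := G)
    (φ := fun u => P + (P * (θ / G.deg i)) * hit i u + (P * (θ / G.deg j)) * hit j u)
    (ψ := fun u v => P + (P * (θ / G.deg i)) * (hit i u + hit i v) +
      (P * (θ / G.deg j)) * (hit j u + hit j v) +
      (P * (θ / G.deg i * (θ / G.deg j))) * (hit i u * hit j v) +
      (P * (θ / G.deg i * (θ / G.deg j))) * (hit j u * hit i v))
    (fun u => (degPow_mul_addVertex_le h0 h1 hi hj hij hdi hdj u).trans (le_of_eq (by ring)))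
    (fun u v => (degPow_mul_addEdge_le h0 h1 hij hdi hdj u v).trans (le_of_eq (by ring)))
  rw [sum_weight_affine₂, sum_sum_weight_bilinear] at key
  have ei := div_deg_mul_weight (θ := θ) hdi
  have ej := div_deg_mul_weight (θ := θ) hdj
  set n : ℝ := (G.edges.card : ℝ)
  refine key.trans (convex_comb_le hp ?_ ?_)
  · rw [mul_assoc P, mul_assoc P, ei, ej]
    have : P + P * (θ / (2 * n)) + P * (θ / (2 * n)) = P * (1 + θ / n) := by field_simp; ring
    rw [this]
    refine mul_le_mul_of_nonneg_left ?_ hP0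
    have : 0 ≤ θ / n := by positivity
    nlinarith
  · have : P + 2 * (P * (θ / G.deg i)) * G.weight i + 2 * (P * (θ / G.deg j)) * G.weight j +
        (P * (θ / G.deg i * (θ / G.deg j)) + P * (θ / G.deg i * (θ / G.deg j))) *
        (G.weight i * G.weight j) = P * (1 + 2 * (θ / G.deg i * G.weight i) +
        2 * (θ / G.deg j * G.weight j) +
        2 * ((θ / G.deg i * G.weight i) * (θ / G.deg j * G.weight j))) := by ring
    rw [this, ei, ej]
    refine mul_le_mul_of_nonneg_left ?_ hP0
    have h : θ / (2 * n) = (θ / n) / 2 := by field_simp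
    rw [h]
    nlinarith [sq_nonneg (θ / n)]

/-- The indicator of a link, completed by `c` times a potential while the link is missing. -/
noncomputable def linkPotential (θ c : ℝ) (i j : ℕ) (G : Multigraph) : ℝ :=
  link i j G + c * ((1 - link i j G) * (degPow θ i G * degPow θ j G))

/-- Here y stands for the product of the two degrees divided by n. The last term on the left is the
effect of a link being formed, which trades the potential y^θ for 1. It is harmless because (1 -
y^θ) y ≤ y^θ: the left side is nonpositive for y ≥ 1, and y ≤ y^θ for y ≤ 1. The other increments
are the growth of the degrees. -/
theorem potential_le {n θ y : ℝ} (hn : 1 ≤ n) (h0 : 0 ≤ θ) (h1 : θ ≤ 1) (hy : 0 ≤ y) :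
    y ^ θ + 2 * y ^ θ * (θ / (2 * n)) + 2 * y ^ θ * (θ / (2 * n)) +
      2 * y ^ θ * ((θ / (2 * n)) * (θ / (2 * n))) + 2 * (1 - y ^ θ) * (y / (4 * n)) ≤
      y ^ θ + 4 * y ^ θ / n := by
  have h6 : (1 - y ^ θ) * y ≤ y ^ θ := by
    rcases le_total 1 y with hy1 | hy1
    · have := Real.one_le_rpow hy1 h0
      nlinarith
    · have hyw : y ≤ y ^ θ := by
        rcases hy.eq_or_lt with h | h
        · rw [← h]; positivity
        · calc y = y ^ (1 : ℝ) := (Real.rpow_one y).symm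
            _ ≤ y ^ θ := Real.rpow_le_rpow_of_exponent_ge h hy1 h1
      nlinarith
  have hw0 : 0 ≤ y ^ θ := by positivity
  set w := y ^ θ
  have e : w + 2 * w * (θ / (2 * n)) + 2 * w * (θ / (2 * n)) +
      2 * w * ((θ / (2 * n)) * (θ / (2 * n))) + 2 * (1 - w) * (y / (4 * n)) =
      w + (2 * w * θ + w * θ ^ 2 / (2 * n) + (1 - w) * y / 2) / n := by field_simp; ring
  rw [e]
  have h2 : w * θ ^ 2 / (2 * n) ≤ w := by
    rw [div_le_iff₀ (by positivity)]
    have : θ ^ 2 ≤ 2 * n := by nlinarith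
    exact mul_le_mul_of_nonneg_left this hw0
  have h3 : w * θ ≤ w := mul_le_of_le_one_right hw0 h1
  gcongr
  linarith

/-- With this `c`, the potential of an unlinked pair is y^θ for y as in `potential_le`. Once the
pair is linked, the value stays 1, so links cost nothing more however large the degrees become. -/
theorem avg_linkPotential_le (hp : p ∈ Set.Icc (0 : ℝ) 1) (h0 : 0 ≤ θ) (h1 : θ ≤ 1)
    (hi : i < G.order) (hj : j < G.order) (hij : i ≠ j) (hdi : 1 ≤ G.deg i) (hdj : 1 ≤ G.deg j)
    {c : ℝ} (hc : c = (G.edges.card : ℝ) ^ (-θ)) :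
    avg p (linkPotential θ c i j) G ≤
      linkPotential θ c i j G + 4 * c / G.edges.card * (degPow θ i G * degPow θ j G) := by
  have hn := one_le_card G
  set P := degPow θ i G * degPow θ j G with hP
  have hP0 : 0 ≤ P := mul_nonneg (degPow_nonneg _ _ _) (degPow_nonneg _ _ _)
  have hc0 : 0 ≤ c := by rw [hc]; positivity
  have ei := div_deg_mul_weight (θ := θ) hdi
  have ej := div_deg_mul_weight (θ := θ) hdj
  rcases link_eq i j G with hl | hl
  · have key := avg_le hp (h := linkPotential θ c i j) (G := G)
      (φ := fun u => c * P + (c * P * (θ / G.deg i)) * hit i u + (c * P * (θ / G.deg j)) * hit j u)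
      (ψ := fun u v => c * P + (c * P * (θ / G.deg i)) * (hit i u + hit i v) +
        (c * P * (θ / G.deg j)) * (hit j u + hit j v) +
        (1 - c * P + c * P * (θ / G.deg i * (θ / G.deg j))) * (hit i u * hit j v) +
        (1 - c * P + c * P * (θ / G.deg i * (θ / G.deg j))) * (hit j u * hit i v))
      (fun u => by
        rw [linkPotential, link_addVertex G u hi hj, hl]
        have := mul_le_mul_of_nonneg_left
          (degPow_mul_addVertex_le h0 h1 hi hj hij hdi hdj u) hc0
        simp only [← hP] at this
        refine (le_of_eq ?_).trans (this.trans (le_of_eq ?_)) <;> ring)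
      (fun u v => by
        rw [linkPotential, link_addEdge G u v hij, hl]
        set e := hit i u * hit j v + hit j u * hit i v with he
        have he1 : e ≤ 1 := by
          simp only [he, hit]
          split_ifs <;> norm_num
          all_goals omega
        have he0 : 0 ≤ e := add_nonneg (mul_nonneg (hit_nonneg _ _) (hit_nonneg _ _))
          (mul_nonneg (hit_nonneg _ _) (hit_nonneg _ _))
        -- Degrees do not decrease, so a new link releases at least the old potential `c * P`; this
        -- replaces the new product by the old one in the term quadratic in the step.
        have h2 : P ≤ degPow θ i (G.addEdge u v) * degPow θ j (G.addEdge u v) := by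
          have hd : ∀ k, degPow θ k G ≤ degPow θ k (G.addEdge u v) := fun k => by
            rw [degPow, degPow]
            refine Real.rpow_le_rpow (by positivity) ?_ h0
            rw [deg_addEdge]
            exact_mod_cast Nat.le_add_right _ _
          exact mul_le_mul (hd i) (hd j) (degPow_nonneg _ _ _) (degPow_nonneg _ _ _)
        have h3 := mul_le_mul_of_nonneg_left
          (degPow_mul_addEdge_le h0 h1 hij hdi hdj u v) hc0
        have h4 : c * (e * P) ≤
            c * (e * (degPow θ i (G.addEdge u v) * degPow θ j (G.addEdge u v))) := by gcongr
        simp only [← hP] at h3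
        have h5 : c * P + (c * P * (θ / G.deg i)) * (hit i u + hit i v) +
            (c * P * (θ / G.deg j)) * (hit j u + hit j v) +
            (1 - c * P + c * P * (θ / G.deg i * (θ / G.deg j))) * (hit i u * hit j v) +
            (1 - c * P + c * P * (θ / G.deg i * (θ / G.deg j))) * (hit j u * hit i v) =
            e - c * (e * P) + c * (P * (1 + θ / G.deg i * (hit i u + hit i v) +
              θ / G.deg j * (hit j u + hit j v) +
              θ / G.deg i * (θ / G.deg j) * (hit i u * hit j v) +
              θ / G.deg i * (θ / G.deg j) * (hit j u * hit i v))) := by rw [he]; ring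
        rw [h5]
        nlinarith)
    rw [sum_weight_affine₂, sum_sum_weight_bilinear] at key
    have hdi' : (1 : ℝ) ≤ G.deg i := by exact_mod_cast hdi
    have hdj' : (1 : ℝ) ≤ G.deg j := by exact_mod_cast hdj
    have hww : G.weight i * G.weight j =
        (G.deg i * G.deg j) / G.edges.card / (4 * G.edges.card) := by
      rw [weight, weight]; field_simp; norm_num
    have hcP : c * P = ((G.deg i * G.deg j) / G.edges.card : ℝ) ^ θ := by
      rw [hc, hP, degPow, degPow, Real.div_rpow (by positivity) (by positivity),
        Real.mul_rpow (by positivity) (by positivity), Real.rpow_neg (by positivity)]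
      field_simp
    have hE : linkPotential θ c i j G = c * P := by rw [linkPotential, hl, ← hP]; ring
    have h4 : 4 * c / G.edges.card * P = 4 * (c * P) / G.edges.card := by ring
    rw [hE, h4]
    have hpot := potential_le hn h0 h1 (y := (G.deg i * G.deg j) / G.edges.card) (by positivity)
    rw [← hcP] at hpot
    have hw0 : 0 ≤ c * P := mul_nonneg hc0 hP0
    refine key.trans (convex_comb_le hp ?_ ((le_of_eq ?_).trans hpot))
    · rw [mul_assoc (c * P), mul_assoc (c * P), ei, ej]
      have h : c * P + c * P * (θ / (2 * G.edges.card)) + c * P * (θ / (2 * G.edges.card)) =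
        c * P + θ * (c * P) / G.edges.card := by field_simp; ring
      rw [h]
      gcongr
      linarith
    · have : c * P + 2 * (c * P * (θ / G.deg i)) * G.weight i +
          2 * (c * P * (θ / G.deg j)) * G.weight j +
          ((1 - c * P + c * P * (θ / G.deg i * (θ / G.deg j))) +
            (1 - c * P + c * P * (θ / G.deg i * (θ / G.deg j)))) * (G.weight i * G.weight j) =
          c * P + 2 * (c * P) * (θ / G.deg i * G.weight i) +
          2 * (c * P) * (θ / G.deg j * G.weight j) +
          2 * (c * P) * ((θ / G.deg i * G.weight i) * (θ / G.deg j * G.weight j)) +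
          2 * (1 - c * P) * (G.weight i * G.weight j) := by ring
      rw [this, ei, ej, hww]
  · have key := avg_le hp (h := linkPotential θ c i j) (G := G) (φ := fun _ => 1)
      (ψ := fun _ _ => 1)
      (fun u => by rw [linkPotential, link_addVertex G u hi hj, hl]; simp)
      (fun u v => by rw [linkPotential, link_addEdge G u v hij, hl]; simp)
    simp only [mul_one, sum_weight, sum_sum_weight] at key
    have : linkPotential θ c i j G = 1 := by rw [linkPotential, hl]; simp
    rw [this]
    have : 0 ≤ 4 * c / G.edges.card * P := by positivity
    linarith

end

end EdgeStep

/-! ### Drift of sums over vertices and pairs, including newborn vertices. -/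

namespace EdgeStep

open Multigraph Finset

section

variable {p θ : ℝ} {G : Multigraph} {i j : ℕ}

theorem avg_sum {ι : Type*} (p : ℝ) (S : Finset ι) (k : ι → Multigraph → ℝ) (G : Multigraph) :
    avg p (fun G => ∑ i ∈ S, k i G) G = ∑ i ∈ S, avg p (k i) G := by
  classical
  induction S using Finset.induction_on with
  | empty => simpa using congrFun (avg_const p 0) G
  | insert a S ha ih => simp only [Finset.sum_insert ha, avg_add, ih]

/-- The expectation of a sum over the old vertices plus the contribution `b u` of a new vertex that
is joined to `u`. -/
theorem avg_le_sum_add {ι : Type*} (hp : p ∈ Set.Icc (0 : ℝ) 1) {h : Multigraph → ℝ}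
    (S : Finset ι) (k : ι → Multigraph → ℝ) (b : Fin G.order → ℝ)
    (h1 : ∀ u, h (G.addVertex u) ≤ ∑ i ∈ S, k i (G.addVertex u) + b u)
    (h2 : ∀ u v, h (G.addEdge u v) ≤ ∑ i ∈ S, k i (G.addEdge u v)) :
    avg p h G ≤ ∑ i ∈ S, avg p (k i) G + p * ∑ u : Fin G.order, G.weight u * b u := by
  refine (avg_le hp h1 h2).trans (le_of_eq ?_)
  rw [← avg_sum, avg]
  simp only [mul_add, Finset.sum_add_distrib]
  ring

/-- The sum of the `θ`-th powers of all degrees. -/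
noncomputable def powSum (θ : ℝ) (G : Multigraph) : ℝ := ∑ i ∈ range G.order, degPow θ i G

/-- The sum of the `θ`-th powers of the products of the degrees of two different vertices. -/
noncomputable def pairSum (θ : ℝ) (G : Multigraph) : ℝ :=
  ∑ q ∈ (range G.order).offDiag, degPow θ q.1 G * degPow θ q.2 G

/-- The sum of the link potentials of all ordered pairs of different vertices. -/
noncomputable def linkSum (θ c : ℝ) (G : Multigraph) : ℝ :=
  ∑ q ∈ (range G.order).offDiag, linkPotential θ c q.1 q.2 G

theorem powSum_nonneg (θ : ℝ) (G : Multigraph) : 0 ≤ powSum θ G :=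
  Finset.sum_nonneg fun _ _ => degPow_nonneg _ _ _

theorem pairSum_nonneg (θ : ℝ) (G : Multigraph) : 0 ≤ pairSum θ G :=
  Finset.sum_nonneg fun _ _ => mul_nonneg (degPow_nonneg _ _ _) (degPow_nonneg _ _ _)

theorem sum_offDiag_range_succ (K : ℕ → ℕ → ℝ) (o : ℕ) :
    ∑ q ∈ (range (o + 1)).offDiag, K q.1 q.2 =
      ∑ q ∈ (range o).offDiag, K q.1 q.2 + ∑ i ∈ range o, (K i o + K o i) := by
  have h : ∀ n, ∑ q ∈ (range n).offDiag, K q.1 q.2 =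
      ∑ i ∈ range n, ∑ j ∈ range n, if i = j then 0 else K i j := fun n => by
    have e : (range n).offDiag = {q ∈ range n ×ˢ range n | q.1 ≠ q.2} := by
      ext q
      simp only [mem_offDiag, mem_filter, mem_product, and_assoc]
    rw [← Finset.sum_product', e, Finset.sum_filter]
    refine Finset.sum_congr rfl fun q _ => ?_
    by_cases hq : q.1 = q.2 <;> simp [hq]
  rw [h, h, Finset.sum_range_succ, Finset.sum_range_succ, if_pos rfl, add_zero]
  simp only [Finset.sum_range_succ, Finset.sum_add_distrib]
  rw [add_assoc]
  congr 2
  · exact Finset.sum_congr rfl fun i hi => if_neg (mem_range.1 hi).ne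
  · exact Finset.sum_congr rfl fun i hi => if_neg (mem_range.1 hi).ne'

theorem order_addVertex (u : Fin G.order) : (G.addVertex u).order = G.order + 1 := rfl

theorem order_addEdge (u v : Fin G.order) : (G.addEdge u v).order = G.order := rfl

theorem avg_powSum_le (hp : p ∈ Set.Icc (0 : ℝ) 1) (h0 : 0 ≤ θ) (h1 : θ ≤ 1)
    (hG : ∀ n < G.order, 1 ≤ G.deg n) :
    avg p (powSum θ) G ≤ powSum θ G * (1 + θ / G.edges.card) + p := by
  refine (avg_le_sum_add hp (range G.order) (degPow θ) (fun _ => 1) ?_ ?_).trans ?_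
  · intro u
    rw [powSum, order_addVertex, Finset.sum_range_succ, degPow_addVertex_order]
  · intro u v
    rfl
  · simp only [mul_one, sum_weight]
    rw [powSum, Finset.sum_mul]
    gcongr with i hi
    exact avg_degPow_le hp h0 h1 (mem_range.1 hi) (hG i (mem_range.1 hi))

/-- A newborn vertex has degree one, so its pairs contribute the degree powers of all old vertices
after the step. On average the step inflates these by at most 1 + θ/2. -/
theorem sum_weight_birth_le (h0 : 0 ≤ θ) (h1 : θ ≤ 1) (hG : ∀ n < G.order, 1 ≤ G.deg n) :
    ∑ u : Fin G.order, G.weight u * ∑ i ∈ range G.order, degPow θ i (G.addVertex u) ≤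
      2 * powSum θ G := by
  have hn := one_le_card G
  simp only [Finset.mul_sum]
  rw [Finset.sum_comm, powSum, Finset.mul_sum]
  refine Finset.sum_le_sum fun i hi => ?_
  have hi' := mem_range.1 hi
  calc ∑ u : Fin G.order, G.weight u * degPow θ i (G.addVertex u)
      ≤ ∑ u : Fin G.order, G.weight u *
          (degPow θ i G + degPow θ i G * (θ / G.deg i) * hit i u) :=
        Finset.sum_le_sum fun u _ => mul_le_mul_of_nonneg_left
          ((degPow_addVertex_le h0 h1 hi' (hG i hi') u).trans (le_of_eq (by ring)))
          (G.weight_nonneg _)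
    _ = degPow θ i G * (1 + θ / (2 * G.edges.card)) := by
        rw [sum_weight_affine, mul_assoc, div_deg_mul_weight (hG i hi')]; ring
    _ ≤ degPow θ i G * 2 := by
        refine mul_le_mul_of_nonneg_left ?_ (degPow_nonneg _ _ _)
        have : θ / (2 * G.edges.card) ≤ 1 := by
          rw [div_le_one (by positivity)]; linarith
        linarith
    _ = 2 * degPow θ i G := by ring

theorem avg_pairSum_le (hp : p ∈ Set.Icc (0 : ℝ) 1) (h0 : 0 ≤ θ) (h1 : θ ≤ 1)
    (hG : ∀ n < G.order, 1 ≤ G.deg n) :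
    avg p (pairSum θ) G ≤ pairSum θ G * (1 + θ / G.edges.card) ^ 2 + 4 * p * powSum θ G := by
  refine (avg_le_sum_add hp (range G.order).offDiag (fun q G => degPow θ q.1 G * degPow θ q.2 G)
    (fun u => 2 * ∑ i ∈ range G.order, degPow θ i (G.addVertex u)) ?_ ?_).trans ?_
  · intro u
    rw [pairSum, order_addVertex,
      sum_offDiag_range_succ (fun i j => degPow θ i (G.addVertex u) * degPow θ j (G.addVertex u)),
      degPow_addVertex_order, Finset.mul_sum]
    gcongr
    linarith
  · intro u v
    rfl
  · have hb := sum_weight_birth_le h0 h1 hG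
    simp only [mul_left_comm _ (2 : ℝ), ← Finset.mul_sum]
    have := mul_le_mul_of_nonneg_left hb hp.1
    refine add_le_add ?_ (by linarith)
    rw [pairSum, Finset.sum_mul]
    refine Finset.sum_le_sum fun q hq => ?_
    obtain ⟨hi, hj, hij⟩ := mem_offDiag.1 hq
    have hi := mem_range.1 hi
    have hj := mem_range.1 hj
    exact avg_degPow_mul_le hp h0 h1 hi hj hij (hG _ hi) (hG _ hj)

theorem linkPotential_comm (θ c : ℝ) (i j : ℕ) (G : Multigraph) :
    linkPotential θ c i j G = linkPotential θ c j i G := by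
  rw [linkPotential, linkPotential, link_comm, mul_comm (degPow θ i G)]

theorem linkPotential_mono {c c' : ℝ} (h : c ≤ c') (i j : ℕ) (G : Multigraph) :
    linkPotential θ c i j G ≤ linkPotential θ c' i j G := by
  rw [linkPotential, linkPotential]
  have := link_mem i j G
  refine add_le_add le_rfl (mul_le_mul_of_nonneg_right h (mul_nonneg (by linarith) ?_))
  exact mul_nonneg (degPow_nonneg _ _ _) (degPow_nonneg _ _ _)

/-- The normalisation decreases in time, and replacing the new constant by the old one only
increases the potential. A newborn vertex has exactly one link, which counts twice among ordered
pairs; this is the summand 2. -/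
theorem avg_linkSum_le (hp : p ∈ Set.Icc (0 : ℝ) 1) (h0 : 0 ≤ θ) (h1 : θ ≤ 1)
    (hG : ∀ n < G.order, 1 ≤ G.deg n) {c c' : ℝ} (hc : c = (G.edges.card : ℝ) ^ (-θ))
    (hc' : c' ≤ c) :
    avg p (linkSum θ c') G ≤ linkSum θ c G + 4 * c / G.edges.card * pairSum θ G +
      p * (2 + 4 * c * powSum θ G) := by
  have hc0 : 0 ≤ c := by rw [hc]; positivity
  refine (avg_le_sum_add hp (range G.order).offDiag (fun q => linkPotential θ c q.1 q.2)
    (fun u => 2 * ∑ i ∈ range G.order, hit i u +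
      2 * c * ∑ i ∈ range G.order, degPow θ i (G.addVertex u)) ?_ ?_).trans ?_
  · intro u
    rw [linkSum, order_addVertex]
    refine (Finset.sum_le_sum fun q _ => linkPotential_mono hc' _ _ _).trans ?_
    rw [sum_offDiag_range_succ (fun i j => linkPotential θ c i j (G.addVertex u)),
      Finset.mul_sum, Finset.mul_sum, ← Finset.sum_add_distrib]
    refine add_le_add le_rfl (Finset.sum_le_sum fun i hi => ?_)
    have hi := mem_range.1 hi
    rw [linkPotential_comm _ _ G.order, linkPotential, link_addVertex_order G u hi,
      degPow_addVertex_order]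
    have h1 := hit_nonneg i u
    have h2 := degPow_nonneg θ i (G.addVertex u)
    have h3 : c * ((1 - hit i u) * (degPow θ i (G.addVertex u) * 1)) ≤
        c * (1 * (degPow θ i (G.addVertex u) * 1)) := by
      gcongr
      linarith
    linarith
  · intro u v
    exact Finset.sum_le_sum fun q _ => linkPotential_mono hc' _ _ _
  · have hb := sum_weight_birth_le h0 h1 hG
    have hb' : ∑ u : Fin G.order, G.weight u * ∑ i ∈ range G.order, hit i u = 1 := by
      rw [← sum_weight]
      refine Finset.sum_congr rfl fun u _ => ?_
      rw [Finset.sum_eq_single (u : ℕ)]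
      · simp [hit]
      · intro i _ hi
        exact if_neg hi.symm
      · intro h
        exact absurd (mem_range.2 u.2) h
    have e : ∑ u : Fin G.order, G.weight u * (2 * ∑ i ∈ range G.order, hit i u +
        2 * c * ∑ i ∈ range G.order, degPow θ i (G.addVertex u)) =
        2 * (∑ u : Fin G.order, G.weight u * ∑ i ∈ range G.order, hit i u) + 2 * c *
        ∑ u : Fin G.order, G.weight u * ∑ i ∈ range G.order, degPow θ i (G.addVertex u) := by
      rw [Finset.mul_sum, Finset.mul_sum _ _ (2 * c), ← Finset.sum_add_distrib]
      exact Finset.sum_congr rfl fun u _ => by ring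
    rw [e, hb']
    refine add_le_add ?_ (mul_le_mul_of_nonneg_left ?_ hp.1)
    · rw [linkSum, pairSum, Finset.mul_sum, ← Finset.sum_add_distrib]
      refine Finset.sum_le_sum fun q hq => ?_
      obtain ⟨hi, hj, hij⟩ := mem_offDiag.1 hq
      have hi := mem_range.1 hi
      have hj := mem_range.1 hj
      exact avg_linkPotential_le hp h0 h1 hi hj hij (hG _ hi) (hG _ hj) hc
    · nlinarith

theorem avg_unlink_le (hp : p ∈ Set.Icc (0 : ℝ) 1) (hi : i < G.order) (hj : j < G.order)
    (hij : i ≠ j) :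
    avg p (fun G => 1 - link i j G) G ≤
      (1 - (1 - p) * (2 * (G.weight i * G.weight j))) * (1 - link i j G) := by
  have key := avg_le hp (h := fun G => 1 - link i j G) (G := G)
    (φ := fun u => (1 - link i j G) + 0 * hit i u)
    (ψ := fun u v => (1 - link i j G) + 0 * (hit i u + hit i v) + 0 * (hit j u + hit j v) +
      (-(1 - link i j G)) * (hit i u * hit j v) + (-(1 - link i j G)) * (hit j u * hit i v))
    (fun u => by rw [link_addVertex G u hi hj]; simp)
    (fun u v => by rw [link_addEdge G u v hij]; apply le_of_eq; ring)
  rw [sum_weight_affine, sum_sum_weight_bilinear] at key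
  refine key.trans (le_of_eq ?_)
  ring

/-- The number of different neighbours of `i`. -/
noncomputable def neighborCount (i : ℕ) (G : Multigraph) : ℕ :=
  #{j ∈ range G.order | j ≠ i ∧ s(i, j) ∈ G.natEdges}

/-- A vertex-operation that hits `i` certainly creates a new neighbour, which halves the power.
Neighbours gained by edge-operations are ignored, as they may repeat old ones. -/
theorem avg_neighborCount_le (hp : p ∈ Set.Icc (0 : ℝ) 1) (hi : i < G.order) :
    avg p (fun G => (1 / 2 : ℝ) ^ neighborCount i G) G ≤
      (1 - p * (G.weight i / 2)) * (1 / 2 : ℝ) ^ neighborCount i G := by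
  set g : ℝ := (1 / 2 : ℝ) ^ neighborCount i G with hg
  have hg0 : 0 ≤ g := by positivity
  have key := avg_le hp (h := fun G => (1 / 2 : ℝ) ^ neighborCount i G) (G := G)
    (φ := fun u => g + (-(g / 2)) * hit i u) (ψ := fun _ _ => g)
    (fun u => by
      have hsub : neighborCount i G + (if (u : ℕ) = i then 1 else 0) ≤
          neighborCount i (G.addVertex u) := by
        have hmono : {j ∈ range G.order | j ≠ i ∧ s(i, j) ∈ G.natEdges} ⊆
            {j ∈ range G.order | j ≠ i ∧ s(i, j) ∈ s((u : ℕ), G.order) ::ₘ G.natEdges} :=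
          Finset.monotone_filter_right _ fun j _ hj => ⟨hj.1, Multiset.mem_cons_of_mem hj.2⟩
        rw [neighborCount, neighborCount, order_addVertex, Finset.range_add_one,
          Finset.filter_insert, natEdges_addVertex]
        split_ifs with h1 h2 h2
        · rw [Finset.card_insert_of_notMem (by simp)]
          exact Nat.add_le_add_right (Finset.card_le_card hmono) 1
        · exact absurd ⟨hi.ne', Multiset.mem_cons.2 (Or.inl (by rw [h1]))⟩ h2
        · exact Finset.card_le_card (hmono.trans (Finset.subset_insert _ _))
        · exact Finset.card_le_card hmono
      refine (pow_le_pow_of_le_one (by norm_num) (by norm_num) hsub).trans (le_of_eq ?_)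
      rw [pow_add, ← hg, hit]
      split_ifs
      · ring
      · ring)
    (fun u v => by
      refine pow_le_pow_of_le_one (by norm_num) (by norm_num) (Finset.card_le_card ?_)
      rw [order_addEdge, natEdges_addEdge]
      exact Finset.monotone_filter_right _ fun j _ hj => ⟨hj.1, Multiset.mem_cons_of_mem hj.2⟩)
  rw [sum_weight_affine] at key
  simp only [← Finset.sum_mul, sum_sum_weight] at key
  refine key.trans (le_of_eq ?_)
  ring

theorem avg_order_le (hp : p ∈ Set.Icc (0 : ℝ) 1) :
    avg p (fun G => (1 / 2 : ℝ) ^ G.order) G ≤ (1 - p / 2) * (1 / 2 : ℝ) ^ G.order := by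
  have key := avg_le hp (h := fun G => (1 / 2 : ℝ) ^ G.order) (G := G)
    (φ := fun u => (1 / 2 : ℝ) ^ G.order * (1 / 2)) (ψ := fun _ _ => (1 / 2 : ℝ) ^ G.order)
    (fun u => by rw [order_addVertex, pow_succ]) (fun u v => le_rfl)
  simp only [← Finset.sum_mul, sum_weight, sum_sum_weight] at key
  refine key.trans (le_of_eq ?_)
  ring

end

end EdgeStep

/-! ### Growth of the expected sums. -/

namespace EdgeStep

open Multigraph Finset

theorem rpow_mul_le_rpow_add_one {q t : ℝ} (hq : 0 ≤ q) (ht : 1 ≤ t) :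
    t ^ q * (1 + q / (t + 1)) ≤ (t + 1) ^ q := by
  have ht0 : 0 < t := by linarith
  have h1 : 1 / (t + 1) ≤ Real.log ((t + 1) / t) := by
    have := Real.one_sub_inv_le_log_of_pos (x := (t + 1) / t) (by positivity)
    refine le_trans (le_of_eq ?_) this
    field_simp
    ring
  have h2 : (t + 1) ^ q = t ^ q * ((t + 1) / t) ^ q := by
    rw [← Real.mul_rpow ht0.le (by positivity)]
    congr 1
    field_simp
  rw [h2]
  refine mul_le_mul_of_nonneg_left ?_ (by positivity)
  rw [Real.rpow_def_of_pos (by positivity)]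
  have h3 := Real.add_one_le_exp (Real.log ((t + 1) / t) * q)
  have h4 := mul_le_mul_of_nonneg_right h1 hq
  have h5 : q / (t + 1) = 1 / (t + 1) * q := by ring
  linarith

/-- A discrete Gronwall argument: the power t^r outgrows the factor ρ by a margin ε/(t+1), and once
A ≥ K/ε this margin absorbs the inhomogeneous term. -/
theorem exists_bound_of_recursion {x ρ y : ℕ → ℝ} {r ε K : ℝ} (hε : 0 < ε)
    (hx : ∀ t, 1 ≤ t → x (t + 1) ≤ x t * ρ t + y t) (hρ : ∀ t, 0 ≤ ρ t)
    (hr : ∀ t : ℕ, 1 ≤ t → (t : ℝ) ^ r * (ρ t + ε / (t + 1)) ≤ ((t : ℝ) + 1) ^ r)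
    (hy : ∀ t : ℕ, 1 ≤ t → y t ≤ K * (t : ℝ) ^ r / (t + 1)) :
    ∃ A > 0, ∀ t : ℕ, 1 ≤ t → x t ≤ A * (t : ℝ) ^ r := by
  refine ⟨max 1 (max (x 1) (K / ε)), lt_max_of_lt_left one_pos, fun t ht => ?_⟩
  set A := max 1 (max (x 1) (K / ε)) with hA
  induction t, ht using Nat.le_induction with
  | base => simp [hA]
  | succ t ht ih =>
    have hK : K ≤ A * ε := by
      rw [← div_le_iff₀ hε]
      exact (le_max_right _ _).trans (le_max_right _ _)
    have ht0 : (0 : ℝ) ≤ (t : ℝ) ^ r := by positivity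
    have h1 := hx t ht
    have h2 := mul_le_mul_of_nonneg_right ih (hρ t)
    have h3 : K * (t : ℝ) ^ r / (t + 1) ≤ A * ε * (t : ℝ) ^ r / (t + 1) := by gcongr
    have h4 := mul_le_mul_of_nonneg_left (hr t ht) (show 0 ≤ A from (zero_le_one.trans
      (le_max_left _ _)))
    have h5 : A * ((t : ℝ) ^ r * (ρ t + ε / (t + 1))) =
        A * (t : ℝ) ^ r * ρ t + A * ε * (t : ℝ) ^ r / (t + 1) := by ring
    push_cast
    linarith [hy t ht]

section

variable {f : ℝ → unitInterval} {θ ε C : ℝ}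

theorem ev_initialGraph_succ_le {t : ℕ} {h h' : Multigraph → ℝ}
    (H : ∀ G, Inv t G → avg (f ((t + 1 : ℕ) : ℝ)) h G ≤ h' G) :
    ev f 0 (t + 1) h initialGraph ≤ ev f 0 t h' initialGraph := by
  rw [ev]
  refine ev_mono preserved_inv (fun G hG => ?_) inv_initialGraph
  rw [zero_add] at hG ⊢
  have := H G hG
  push_cast at this
  exact this

theorem add_one_rpow_le {q : ℝ} (hq : q ≤ 2) (hq0 : 0 ≤ q) {t : ℕ} (ht : 1 ≤ t) :
    ((t : ℝ) + 1) ^ (q - 1) ≤ 4 * (t : ℝ) ^ q / (t + 1) := by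
  have ht' : (1 : ℝ) ≤ t := by exact_mod_cast ht
  rw [Real.rpow_sub (by positivity), Real.rpow_one]
  refine div_le_div_of_nonneg_right ?_ (by positivity)
  calc ((t : ℝ) + 1) ^ q ≤ (2 * t) ^ q := Real.rpow_le_rpow (by positivity) (by linarith) hq0
    _ = 2 ^ q * (t : ℝ) ^ q := Real.mul_rpow (by norm_num) (by positivity)
    _ ≤ 2 ^ (2 : ℝ) * (t : ℝ) ^ q := by
      gcongr
      norm_num
    _ = _ := by norm_num

/-- The multiplicative drift alone would give t^θ, and births add about t^(θ+ε-1) per step. The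
extra ε in the exponent is the margin needed for the recursion. -/
theorem exists_ev_powSum_le (h0 : 0 ≤ θ) (h1 : θ ≤ 1) (hε : 0 < ε) (hε1 : ε ≤ 1) (hC : 0 < C)
    (hf : ∀ n : ℕ, 1 ≤ n → (f n : ℝ) ≤ C * (n : ℝ) ^ (θ + ε - 1)) :
    ∃ A > 0, ∀ t : ℕ, 1 ≤ t → ev f 0 t (powSum θ) initialGraph ≤ A * (t : ℝ) ^ (θ + ε) := by
  refine exists_bound_of_recursion (ρ := fun t => 1 + θ / (t + 1))
    (y := fun t => (f ((t + 1 : ℕ) : ℝ) : ℝ)) (K := 4 * C) hε ?_ ?_ ?_ ?_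
  · intro t ht
    have h : ev f 0 (t + 1) (powSum θ) initialGraph ≤ ev f 0 t
        (fun G => (1 + θ / (t + 1)) * powSum θ G + (f ((t + 1 : ℕ) : ℝ) : ℝ)) initialGraph := by
      refine ev_initialGraph_succ_le fun G hG => ?_
      have := avg_powSum_le (p := f ((t + 1 : ℕ) : ℝ)) (f _).2 h0 h1 hG.2
      rw [hG.1] at this
      push_cast at *
      linarith
    rw [ev_add_fun, ev_mul_left, ev_const] at h
    linarith
  · intro t; positivity
  · intro t ht
    refine le_trans (le_of_eq ?_) (rpow_mul_le_rpow_add_one (q := θ + ε) (by positivity)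
      (by exact_mod_cast ht))
    ring
  · intro t ht
    refine (hf (t + 1) (by omega)).trans ?_
    have := mul_le_mul_of_nonneg_left
      (add_one_rpow_le (q := θ + ε) (by linarith) (by linarith) ht) hC.le
    push_cast
    refine this.trans (le_of_eq ?_)
    ring

theorem exists_ev_pairSum_le (h0 : 0 ≤ θ) (h1 : θ ≤ 1) (hε : 0 < ε) (hε1 : ε ≤ 1) (hC : 0 < C)
    (hf : ∀ n : ℕ, 1 ≤ n → (f n : ℝ) ≤ C * (n : ℝ) ^ (θ + ε - 1)) :
    ∃ B > 0, ∀ t : ℕ, 1 ≤ t → ev f 0 t (pairSum θ) initialGraph ≤ B * (t : ℝ) ^ (2 * θ + 2 * ε) := by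
  obtain ⟨A, hA, hS⟩ := exists_ev_powSum_le h0 h1 hε hε1 hC hf
  refine exists_bound_of_recursion (ρ := fun t => (1 + θ / (t + 1)) ^ 2)
    (y := fun t => 4 * (f ((t + 1 : ℕ) : ℝ) : ℝ) * ev f 0 t (powSum θ) initialGraph)
    (K := 16 * C * A) hε ?_ ?_ ?_ ?_
  · intro t ht
    have h : ev f 0 (t + 1) (pairSum θ) initialGraph ≤ ev f 0 t
        (fun G => (1 + θ / (t + 1)) ^ 2 * pairSum θ G +
          4 * (f ((t + 1 : ℕ) : ℝ) : ℝ) * powSum θ G) initialGraph := by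
      refine ev_initialGraph_succ_le fun G hG => ?_
      have := avg_pairSum_le (p := f ((t + 1 : ℕ) : ℝ)) (f _).2 h0 h1 hG.2
      rw [hG.1] at this
      push_cast at *
      linarith
    rw [ev_add_fun, ev_mul_left, ev_mul_left] at h
    linarith
  · intro t; positivity
  · intro t ht
    have ht' : (1 : ℝ) ≤ t := by exact_mod_cast ht
    have h := rpow_mul_le_rpow_add_one (q := θ + ε) (t := t) (by positivity) ht'
    have e : ∀ z : ℝ, 0 ≤ z → z ^ (2 * θ + 2 * ε) = (z ^ (θ + ε)) ^ 2 := fun z hz => by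
      rw [← Real.rpow_natCast, ← Real.rpow_mul hz]
      congr 1
      push_cast
      ring
    rw [e _ (by positivity), e _ (by positivity)]
    refine le_trans ?_ (pow_le_pow_left₀ (by positivity) h 2)
    rw [mul_pow]
    refine mul_le_mul_of_nonneg_left ?_ (by positivity)
    have h3 : (θ + ε) / ((t : ℝ) + 1) = θ / (t + 1) + ε / (t + 1) := by ring
    rw [h3]
    have h4 : 0 ≤ θ / ((t : ℝ) + 1) := by positivity
    have h5 : 0 ≤ ε / ((t : ℝ) + 1) := by positivity
    nlinarith
  · intro t ht
    have h2 := hf (t + 1) (by omega)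
    have h3 := mul_le_mul_of_nonneg_left
      (add_one_rpow_le (q := θ + ε) (by linarith) (by linarith) ht) hC.le
    push_cast at h2 h3 ⊢
    have e : (t : ℝ) ^ (2 * θ + 2 * ε) = (t : ℝ) ^ (θ + ε) * (t : ℝ) ^ (θ + ε) := by
      rw [← Real.rpow_add (by exact_mod_cast ht)]
      congr 1
      ring
    have h4 : (f ((t : ℝ) + 1) : ℝ) * ev f 0 t (powSum θ) initialGraph ≤
        (C * (4 * (t : ℝ) ^ (θ + ε) / (t + 1))) * (A * (t : ℝ) ^ (θ + ε)) :=
      mul_le_mul (h2.trans h3) (hS t ht) (ev_nonneg (powSum_nonneg θ) _) (by positivity)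
    rw [e]
    have h5 : 16 * C * A * ((t : ℝ) ^ (θ + ε) * (t : ℝ) ^ (θ + ε)) / (t + 1) =
      4 * ((C * (4 * (t : ℝ) ^ (θ + ε) / (t + 1))) * (A * (t : ℝ) ^ (θ + ε))) := by ring
    rw [h5]
    linarith

theorem exists_ev_linkSum_le (h0 : 0 ≤ θ) (h1 : θ ≤ 1) (hε : 0 < ε) (hε1 : ε ≤ 1) (hC : 0 < C)
    (hf : ∀ n : ℕ, 1 ≤ n → (f n : ℝ) ≤ C * (n : ℝ) ^ (θ + ε - 1)) :
    ∃ D > 0, ∀ t : ℕ, 1 ≤ t → ev f 0 t (linkSum θ (((t : ℝ) + 1) ^ (-θ))) initialGraph ≤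
      D * (t : ℝ) ^ (θ + 2 * ε) := by
  obtain ⟨A, hA, hS⟩ := exists_ev_powSum_le h0 h1 hε hε1 hC hf
  obtain ⟨B, hB, hP⟩ := exists_ev_pairSum_le h0 h1 hε hε1 hC hf
  -- The potential itself has no multiplicative drift. The input per step is t^(-θ-1) times the pair
  -- sum t^(2θ+2ε), plus births at rate t^(θ+ε-1), each costing at most a constant times t^ε.
  refine exists_bound_of_recursion (x := fun t => ev f 0 t (linkSum θ (((t : ℝ) + 1) ^ (-θ)))
      initialGraph) (ρ := fun t => 1)
    (y := fun t => 4 * ((t : ℝ) + 1) ^ (-θ) / (t + 1) * ev f 0 t (pairSum θ) initialGraph +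
      (f ((t + 1 : ℕ) : ℝ) : ℝ) * (2 + 4 * ((t : ℝ) + 1) ^ (-θ) *
        ev f 0 t (powSum θ) initialGraph))
    (K := 4 * B + C * 4 * (2 + 4 * A)) hε ?_ (fun _ => zero_le_one) ?_ ?_
  · intro t ht
    have h : ev f 0 (t + 1) (linkSum θ ((((t + 1 : ℕ) : ℝ) + 1) ^ (-θ))) initialGraph ≤ ev f 0 t
        (fun G => linkSum θ (((t : ℝ) + 1) ^ (-θ)) G +
          (4 * ((t : ℝ) + 1) ^ (-θ) / (t + 1) * pairSum θ G +
          (f ((t + 1 : ℕ) : ℝ) : ℝ) * (2 + 4 * ((t : ℝ) + 1) ^ (-θ) * powSum θ G)))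
          initialGraph := by
      refine ev_initialGraph_succ_le fun G hG => ?_
      have hc : (G.edges.card : ℝ) = (t : ℝ) + 1 := by
        rw [hG.1]; push_cast; ring
      have := avg_linkSum_le (p := f ((t + 1 : ℕ) : ℝ)) (f _).2 h0 h1 hG.2
        (c := ((t : ℝ) + 1) ^ (-θ)) (c' := (((t + 1 : ℕ) : ℝ) + 1) ^ (-θ)) (by rw [hc])
        (Real.rpow_le_rpow_of_nonpos (by positivity) (by push_cast; linarith) (by linarith))
      rw [hc] at this
      push_cast at *
      linarith
    simp only [ev_add_fun, ev_mul_left, ev_const] at h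
    linarith
  · intro t ht
    have ht' : (1 : ℝ) ≤ t := by exact_mod_cast ht
    refine le_trans ?_ (rpow_mul_le_rpow_add_one (q := θ + 2 * ε) (by positivity) ht')
    gcongr
    linarith
  · intro t ht
    have ht' : (1 : ℝ) ≤ t := by exact_mod_cast ht
    have h2 := hf (t + 1) (by omega)
    have h3 := mul_le_mul_of_nonneg_left
      (add_one_rpow_le (q := θ + ε) (by linarith) (by linarith) ht) hC.le
    have hneg : ((t : ℝ) + 1) ^ (-θ) ≤ (t : ℝ) ^ (-θ) :=
      Real.rpow_le_rpow_of_nonpos (by positivity) (by linarith) (by linarith)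
    have e1 : (t : ℝ) ^ (-θ) * (t : ℝ) ^ (2 * θ + 2 * ε) = (t : ℝ) ^ (θ + 2 * ε) := by
      rw [← Real.rpow_add (by positivity)]; congr 1; ring
    have e2 : (t : ℝ) ^ (-θ) * (t : ℝ) ^ (θ + ε) = (t : ℝ) ^ ε := by
      rw [← Real.rpow_add (by positivity)]; congr 1; ring
    have e3 : (t : ℝ) ^ (θ + ε) * (t : ℝ) ^ ε = (t : ℝ) ^ (θ + 2 * ε) := by
      rw [← Real.rpow_add (by positivity)]; congr 1; ring
    have hε' : 1 ≤ (t : ℝ) ^ ε := Real.one_le_rpow ht' hε.le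
    have h4 : ((t : ℝ) + 1) ^ (-θ) * ev f 0 t (pairSum θ) initialGraph ≤
        B * (t : ℝ) ^ (θ + 2 * ε) := by
      rw [← e1]
      refine (mul_le_mul hneg (hP t ht) (ev_nonneg (pairSum_nonneg θ) _)
        (by positivity)).trans (le_of_eq (by ring))
    have h5 : ((t : ℝ) + 1) ^ (-θ) * ev f 0 t (powSum θ) initialGraph ≤ A * (t : ℝ) ^ ε := by
      rw [← e2]
      refine (mul_le_mul hneg (hS t ht) (ev_nonneg (powSum_nonneg θ) _)
        (by positivity)).trans (le_of_eq (by ring))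
    have h6 : 2 + 4 * ((t : ℝ) + 1) ^ (-θ) * ev f 0 t (powSum θ) initialGraph ≤
        (2 + 4 * A) * (t : ℝ) ^ ε := by nlinarith
    have h7 : (f ((t : ℝ) + 1) : ℝ) * (2 + 4 * ((t : ℝ) + 1) ^ (-θ) *
        ev f 0 t (powSum θ) initialGraph) ≤
        (C * (4 * (t : ℝ) ^ (θ + ε) / (t + 1))) * ((2 + 4 * A) * (t : ℝ) ^ ε) := by
      push_cast at h2 h3
      refine mul_le_mul (h2.trans h3) h6 ?_ (by positivity)
      have := ev_nonneg (f := f) (s := 0) (k := t) (powSum_nonneg θ) initialGraph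
      positivity
    have h8 : 4 * ((t : ℝ) + 1) ^ (-θ) / (t + 1) * ev f 0 t (pairSum θ) initialGraph ≤
        4 * (B * (t : ℝ) ^ (θ + 2 * ε)) / (t + 1) := by
      rw [div_mul_eq_mul_div, mul_assoc]
      gcongr
    have h9 : (4 * B + C * 4 * (2 + 4 * A)) * (t : ℝ) ^ (θ + 2 * ε) / (t + 1) =
        4 * (B * (t : ℝ) ^ (θ + 2 * ε)) / (t + 1) +
        (C * (4 * (t : ℝ) ^ (θ + ε) / (t + 1))) * ((2 + 4 * A) * (t : ℝ) ^ ε) := by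
      rw [← e3]; ring
    rw [h9]
    push_cast
    exact add_le_add h8 h7

end

end EdgeStep

/-! ### Tail bounds for degrees, links, neighbours and the order. -/

namespace EdgeStep

open Multigraph Finset

section

variable {f : ℝ → unitInterval}

theorem ev_indic_le_div {I : ℕ → Multigraph → Prop} (hI : Preserved I) {s k : ℕ} {H : Multigraph}
    (hH : I s H) {h : Multigraph → ℝ} (h0 : ∀ G, 0 ≤ h G) {y : ℝ} (hy : 0 < y)
    {P : Multigraph → Prop} (hP : ∀ G, I (s + k) G → P G → y ≤ h G) :
    ev f s k (fun G => indic (P G)) H ≤ ev f s k h H / y := by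
  have := ev_mono (f := f) hI (s := s) (k := k) (h := fun G => indic (P G))
    (h' := fun G => y⁻¹ * h G) (fun G hG => indic_le (by have := h0 G; positivity) fun hPG => by
      rw [inv_mul_eq_div, le_div_iff₀ hy, one_mul]
      exact hP G hG hPG) hH
  rw [ev_mul_left] at this
  rw [div_eq_inv_mul]
  exact this

theorem ev_le_pow {I : ℕ → Multigraph → Prop} (hI : Preserved I) {s k : ℕ} {H : Multigraph}
    (hH : I s H) {h : Multigraph → ℝ} {ρ : ℝ} (hρ : 0 ≤ ρ)
    (hstep : ∀ j < k, ∀ G, I (s + j) G → avg (f (((s + j : ℕ) : ℝ) + 1)) h G ≤ ρ * h G) :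
    ev f s k h H ≤ ρ ^ k * h H := by
  induction k with
  | zero => simp [ev]
  | succ k ih =>
    have h1 := ev_mono (f := f) hI (hstep k k.lt_succ_self) hH
    rw [ev_mul_left] at h1
    have h2 := mul_le_mul_of_nonneg_left (ih fun j hj => hstep j (hj.trans k.lt_succ_self)) hρ
    rw [pow_succ', mul_assoc]
    exact h1.trans h2

/-- By Bernoulli the power grows at most by 1 + κ/n, and (1 + κ/n)(1 - κ'/n) ≤ 1. This turns a drift
of -κ'/n into a decay like n^(-κ). -/
theorem add_one_rpow_mul_le {n κ κ' : ℝ} (hn : 1 ≤ n) (h0 : 0 ≤ κ) (h1 : κ ≤ 1) (h : κ ≤ κ') :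
    (n + 1) ^ κ * (1 - κ' / n) ≤ n ^ κ := by
  have hn0 : 0 < n := by linarith
  rcases le_total (1 - κ' / n) 0 with h2 | h2
  · exact (mul_nonpos_of_nonneg_of_nonpos (by positivity) h2).trans (by positivity)
  · have h3 := rpow_add_le h0 h1 hn zero_le_one
    have h4 : κ / n ≤ κ' / n := by gcongr
    have h5 : 0 ≤ κ / n := by positivity
    have h6 : κ * (1 / n) = κ / n := by ring
    rw [h6] at h3
    calc (n + 1) ^ κ * (1 - κ' / n) ≤ n ^ κ * (1 + κ / n) * (1 - κ' / n) := by gcongr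
      _ = n ^ κ * ((1 + κ / n) * (1 - κ' / n)) := by ring
      _ ≤ n ^ κ * 1 := by gcongr; nlinarith
      _ = n ^ κ := mul_one _

/-- The lower tail of the degree of a vertex. -/
theorem ev_deg_lt_le {τ : ℝ} (hτ : 0 < τ) (hτ' : τ ≤ 1 / 2) {s k i : ℕ} {H : Multigraph}
    (hH : Inv s H) (hi : i < H.order)
    (hf : ∀ u : ℕ, s ≤ u → (f ((u : ℝ) + 1) : ℝ) + 1 / ((u : ℝ) + 1) ≤ 2 * τ) {x : ℝ} (hx : 0 < x) :
    ev f s k (fun G => indic ((G.deg i : ℝ) < x)) H ≤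
      Real.exp τ * x ^ τ * (((s : ℝ) + 1) / (s + k + 1)) ^ (τ * (1 - 2 * τ)) := by
  set κ := τ * (1 - 2 * τ) with hκ
  have hκ0 : 0 ≤ κ := mul_nonneg hτ.le (by linarith)
  have hκ1 : κ ≤ 1 := by nlinarith
  set D : ℝ := (s : ℝ) + k + 1 with hD
  have hD0 : 0 < D := by positivity
  have hH' := And.intro hH hi
  have hI := preserved_inv.and (preserved_lt_order i)
  -- At time `s + j` there are `s + j + 1` edges; multiplied by the κ-th power of this number,
  -- `decay` becomes a supermartingale. Division by `D` makes the final factor 1.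
  have h1 : ev f s k (fun G => (((s : ℝ) + k + 1) / D) ^ κ * decay τ (G.deg i)) H ≤
      (((s : ℝ) + (0 : ℕ) + 1) / D) ^ κ * decay τ (H.deg i) := by
    refine ev_le_of_step hI (fun j G => (((s : ℝ) + j + 1) / D) ^ κ * decay τ (G.deg i)) ?_ hH'
    intro j hj G hG
    rw [avg_mul_left]
    have h2 := avg_decay_le (p := f (((s + j : ℕ) : ℝ) + 1)) (f _).2 hτ (by linarith) hG.2
      (hG.1.2 i hG.2)
    have hn : (G.edges.card : ℝ) = (s : ℝ) + j + 1 := by rw [hG.1.1]; push_cast; ring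
    have h3 := hf (s + j) (Nat.le_add_right _ _)
    rw [hn] at h2
    push_cast at h2 h3 ⊢
    set n : ℝ := (s : ℝ) + j + 1 with hnn
    have hn1 : 1 ≤ n := by
      have : (0 : ℝ) ≤ (s : ℝ) + j := by positivity
      linarith
    set κ' := τ / (1 + τ) * (1 - ((f n : ℝ) + 1 / n) / 2) with hκ'
    -- The hypothesis on `f` leaves at least τ(1-τ)/(1+τ), and (1-2τ)(1+τ) ≤ 1-τ.
    have h4 : κ ≤ κ' := by
      have : κ ≤ τ / (1 + τ) * (1 - τ) := by
        rw [div_mul_eq_mul_div, le_div_iff₀ (by positivity), hκ]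
        nlinarith [mul_nonneg hτ.le (sq_nonneg τ)]
      refine this.trans ?_
      rw [hκ']
      gcongr
      linarith
    have h5 := add_one_rpow_mul_le hn1 hκ0 hκ1 h4
    have hg := (decay_pos hτ.le (G.deg i)).le
    have e : (s : ℝ) + (j + 1) + 1 = n + 1 := by rw [hnn]; ring
    rw [e, Real.div_rpow (by positivity) hD0.le, Real.div_rpow (by positivity) hD0.le]
    calc (n + 1) ^ κ / D ^ κ * avg (f n) (fun G => decay τ (G.deg i)) G
        ≤ (n + 1) ^ κ / D ^ κ * ((1 - κ' / n) * decay τ (G.deg i)) := by gcongr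
      _ = ((n + 1) ^ κ * (1 - κ' / n)) / D ^ κ * decay τ (G.deg i) := by ring
      _ ≤ n ^ κ / D ^ κ * decay τ (G.deg i) := by gcongr
  have h2 : ((s : ℝ) + k + 1) / D = 1 := div_self hD0.ne'
  rw [h2, Nat.cast_zero, add_zero] at h1
  simp only [Real.one_rpow, one_mul] at h1
  have h3 := ev_indic_le_div (f := f) (k := k) hI hH' (h := fun G => decay τ (G.deg i))
    (fun G => (decay_pos hτ.le _).le) (y := Real.exp (-τ) * x ^ (-τ)) (by positivity)
    (P := fun G => (G.deg i : ℝ) < x) (fun G hG hP => by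
      have hd := hG.1.2 i hG.2
      refine le_trans ?_ (le_decay hτ.le hd)
      gcongr ?_ * ?_
      exact Real.rpow_le_rpow_of_nonpos (by exact_mod_cast hd) hP.le (by linarith))
  refine h3.trans ?_
  have h4 : ev f s k (fun G => decay τ (G.deg i)) H ≤ (((s : ℝ) + 1) / D) ^ κ :=
    h1.trans (mul_le_of_le_one_right (by positivity) (decay_le_one hτ.le _))
  rw [div_le_iff₀ (by positivity)]
  refine h4.trans (le_of_eq ?_)
  have e1 : Real.exp τ * Real.exp (-τ) = 1 := by rw [← Real.exp_add]; simp
  have e2 : x ^ τ * x ^ (-τ) = 1 := by rw [← Real.rpow_add hx]; simp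
  calc (((s : ℝ) + 1) / D) ^ κ = (((s : ℝ) + 1) / D) ^ κ *
        (Real.exp τ * Real.exp (-τ)) * (x ^ τ * x ^ (-τ)) := by rw [e1, e2]; ring
    _ = _ := by ring

theorem one_sub_mul_le_exp_mul {a b z : ℝ} (hab : a ≤ b) (hz : 0 ≤ z) :
    (1 - b) * z ≤ Real.exp (-a) * z := by
  refine mul_le_mul_of_nonneg_right ?_ hz
  have := Real.one_sub_le_exp_neg a
  linarith

theorem le_weight {x T : ℝ} {i : ℕ} {G : Multigraph} (_hx : 0 ≤ x) (hd : x ≤ G.deg i)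
    (hT : (G.edges.card : ℝ) ≤ T) : x / (2 * T) ≤ G.weight i := by
  have := one_le_card G
  rw [weight]
  gcongr

/-- Two vertices of large degree are linked soon. -/
theorem ev_unlink_le {s k i j : ℕ} {H : Multigraph} (hH : Inv s H) (hi : i < H.order)
    (hj : j < H.order) (hij : i ≠ j) (hf : ∀ u : ℕ, s ≤ u → (f ((u : ℝ) + 1) : ℝ) ≤ 1 / 2)
    {x : ℝ} (hx : 0 ≤ x) (hdi : x ≤ H.deg i) (hdj : x ≤ H.deg j) :
    ev f s k (fun G => 1 - link i j G) H ≤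
      Real.exp (-(x / (2 * (s + k + 1))) ^ 2) ^ k := by
  have hI := ((preserved_inv.and (preserved_lt_order i)).and (preserved_lt_order j)).and
    ((preserved_le_deg i x).and (preserved_le_deg j x))
  have h := ev_le_pow (f := f) (k := k) hI (s := s) (H := H)
    ⟨⟨⟨hH, hi⟩, hj⟩, hdi, hdj⟩ (h := fun G => 1 - link i j G)
    (ρ := Real.exp (-(x / (2 * (s + k + 1))) ^ 2)) (Real.exp_pos _).le ?_
  · refine h.trans (mul_le_of_le_one_right (by positivity) ?_)
    have := link_mem i j H
    linarith
  · rintro l hl G ⟨⟨⟨hG, hiG⟩, hjG⟩, hdiG, hdjG⟩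
    refine (avg_unlink_le (f _).2 hiG hjG hij).trans ?_
    have hc : (G.edges.card : ℝ) ≤ (s : ℝ) + k + 1 := by
      rw [hG.1]; exact_mod_cast (by omega : s + l + 1 ≤ s + k + 1)
    refine one_sub_mul_le_exp_mul ?_ (by linarith [link_mem i j G])
    have h1 := le_weight hx hdiG hc
    have h2 := le_weight hx hdjG hc
    -- With p ≤ 1/2 the factor 2(1 - p) is at least 1, so the chance of a link is at least the
    -- product of the weights.
    have h3 := hf (s + l) (Nat.le_add_right _ _)
    have h4 : 0 ≤ x / (2 * ((s : ℝ) + k + 1)) := by positivity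
    have h5 := mul_le_mul h1 h2 h4 (G.weight_nonneg i)
    have h6 : 0 ≤ G.weight i * G.weight j := mul_nonneg (G.weight_nonneg i) (G.weight_nonneg j)
    nlinarith

theorem ev_neighborCount_le {s k i : ℕ} {H : Multigraph} (hH : Inv s H) (hi : i < H.order)
    {x φ : ℝ} (_hφ : 0 ≤ φ) (hf : ∀ u : ℕ, u < s + k → φ ≤ f ((u : ℝ) + 1))
    (hx : 0 ≤ x) (hdi : x ≤ H.deg i) :
    ev f s k (fun G => (1 / 2 : ℝ) ^ neighborCount i G) H ≤
      Real.exp (-(φ * (x / (4 * (s + k + 1))))) ^ k := by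
  have hI := (preserved_inv.and (preserved_lt_order i)).and (preserved_le_deg i x)
  have h := ev_le_pow (f := f) (k := k) hI (s := s) (H := H)
    ⟨⟨hH, hi⟩, hdi⟩ (h := fun G => (1 / 2 : ℝ) ^ neighborCount i G)
    (ρ := Real.exp (-(φ * (x / (4 * (s + k + 1)))))) (Real.exp_pos _).le ?_
  · exact h.trans (mul_le_of_le_one_right (by positivity)
      (pow_le_one₀ (by norm_num) (by norm_num)))
  · rintro l hl G ⟨⟨hG, hiG⟩, hdiG⟩
    refine (avg_neighborCount_le (f _).2 hiG).trans ?_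
    have hc : (G.edges.card : ℝ) ≤ (s : ℝ) + k + 1 := by
      rw [hG.1]; exact_mod_cast (by omega : s + l + 1 ≤ s + k + 1)
    refine one_sub_mul_le_exp_mul ?_ (by positivity)
    have h1 := le_weight hx hdiG hc
    have h3 := hf (s + l) (by omega)
    have h4 : x / (4 * ((s : ℝ) + k + 1)) = x / (2 * ((s : ℝ) + k + 1)) / 2 := by
      field_simp; norm_num
    rw [h4]
    have h5 : 0 ≤ x / (2 * ((s : ℝ) + k + 1)) := by positivity
    exact mul_le_mul h3 (by linarith) (by positivity) (f _).2.1

theorem ev_order_le {k : ℕ} {φ : ℝ} (hf : ∀ u : ℕ, u < k → φ ≤ f ((u : ℝ) + 1)) :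
    ev f 0 k (fun G => (1 / 2 : ℝ) ^ G.order) initialGraph ≤ Real.exp (-(φ / 2)) ^ k := by
  have h := ev_le_pow (f := f) (k := k) preserved_inv (s := 0) inv_initialGraph
    (h := fun G => (1 / 2 : ℝ) ^ G.order) (ρ := Real.exp (-(φ / 2))) (Real.exp_pos _).le ?_
  · exact h.trans (mul_le_of_le_one_right (by positivity)
      (pow_le_one₀ (by norm_num) (by norm_num)))
  · rintro l hl G -
    refine (avg_order_le (f _).2).trans (one_sub_mul_le_exp_mul ?_ (by positivity))
    rw [zero_add]
    linarith [hf l hl]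

/-- An exponential Markov inequality: (1/2)^N ≥ e^(-N) > e^(-y) on the event N < y. -/
theorem ev_indic_count_lt_le {s k : ℕ} (H : Multigraph) (N : Multigraph → ℕ) (y : ℝ) :
    ev f s k (fun G => indic ((N G : ℝ) < y)) H ≤
      Real.exp y * ev f s k (fun G => (1 / 2 : ℝ) ^ N G) H := by
  have h := ev_indic_le_div (f := f) (k := k) (s := s) (H := H) (I := fun _ _ => True)
    (fun _ _ _ => ⟨fun _ => trivial, fun _ _ => trivial⟩) trivial
    (h := fun G => (1 / 2 : ℝ) ^ N G) (fun G => by positivity) (Real.exp_pos (-y))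
    (P := fun G => (N G : ℝ) < y) (fun G _ hG => by
      have h1 : Real.exp (-1) ≤ 1 / 2 := by
        rw [Real.exp_neg, inv_eq_one_div]
        have := Real.add_one_le_exp 1
        exact one_div_le_one_div_of_le (by norm_num) (by linarith)
      calc Real.exp (-y) ≤ Real.exp (-(N G : ℝ)) := Real.exp_le_exp.2 (by linarith)
        _ = Real.exp (-1) ^ N G := by rw [← Real.exp_nat_mul]; simp
        _ ≤ _ := pow_le_pow_left₀ (Real.exp_pos _).le h1 _)
  refine h.trans (le_of_eq ?_)
  rw [Real.exp_neg, div_inv_eq_mul, mul_comm]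

end

end EdgeStep

/-! ### Deterministic counting of triangles and cherries. -/

namespace EdgeStep

open Multigraph Finset

open Classical in
/-- The adjacency indicator. -/
noncomputable def adjInd {V : Type*} (H : SimpleGraph V) (x y : V) : ℝ := if H.Adj x y then 1 else 0

theorem adjInd_mem {V : Type*} (H : SimpleGraph V) (x y : V) : 0 ≤ adjInd H x y ∧ adjInd H x y ≤ 1 := by
  unfold adjInd; split_ifs <;> norm_num

theorem adjInd_sq {V : Type*} (H : SimpleGraph V) (x y : V) : adjInd H x y ^ 2 = adjInd H x y := by
  unfold adjInd; split_ifs <;> norm_num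

section counts

variable {V : Type*} [Fintype V] (H : SimpleGraph V)

open Classical in
/-- The ordered pairs of adjacent vertices. -/
noncomputable def adjPairs : Finset (V × V) := {q | H.Adj q.1 q.2}

open Classical in
/-- The ordered triples of pairwise adjacent vertices. -/
noncomputable def adjTriples : Finset (V × V × V) :=
  {q | H.Adj q.1 q.2.1 ∧ H.Adj q.1 q.2.2 ∧ H.Adj q.2.1 q.2.2}

open Classical in
theorem image_adjTriples :
    H.cliqueFinset 3 = (adjTriples H).image fun q => ({q.1, q.2.1, q.2.2} : Finset V) := by
  ext s
  rw [SimpleGraph.mem_cliqueFinset_iff, SimpleGraph.is3Clique_iff, mem_image]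
  constructor
  · rintro ⟨a, b, c, h1, h2, h3, rfl⟩
    exact ⟨(a, b, c), by simp [adjTriples, h1, h2, h3], rfl⟩
  · rintro ⟨⟨a, b, c⟩, h, rfl⟩
    have h := (mem_filter.1 h).2
    exact ⟨a, b, c, h.1, h.2.1, h.2.2, rfl⟩

theorem triangles_le : triangles H ≤ #(adjTriples H) := by
  classical
  rw [triangles, image_adjTriples]
  exact card_image_le

/-- At most 3³ ordered triples have their entries in a given set of at most three elements. The true
multiplicity is 6, but constants do not matter here. -/
theorem card_adjTriples_le : #(adjTriples H) ≤ 27 * triangles H := by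
  classical
  rw [triangles, image_adjTriples]
  refine card_le_mul_card_image (f := fun q : V × V × V => ({q.1, q.2.1, q.2.2} : Finset V)) _ _
    fun s hs => ?_
  obtain ⟨q, hq, rfl⟩ := mem_image.1 hs
  set s : Finset V := {q.1, q.2.1, q.2.2} with hsdef
  have hc : #s ≤ 3 := card_le_three
  calc #{a ∈ adjTriples H | ({a.1, a.2.1, a.2.2} : Finset V) = s} ≤ #(s ×ˢ (s ×ˢ s)) := by
        refine card_le_card fun a ha => ?_
        have ha := (mem_filter.1 ha).2
        simp only [mem_product, ← ha]
        simp
    _ = #s * (#s * #s) := by rw [card_product, card_product]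
    _ ≤ 3 * (3 * 3) := by gcongr
    _ = 27 := rfl

theorem card_adjPairs_eq : (#(adjPairs H) : ℝ) = ∑ x, ∑ y, adjInd H x y := by
  classical
  rw [adjPairs, ← Fintype.sum_prod_type', Finset.card_filter]
  push_cast
  rfl

theorem card_adjTriples_eq :
    (#(adjTriples H) : ℝ) = ∑ x, ∑ y, adjInd H x y * ∑ z, adjInd H x z * adjInd H y z := by
  classical
  simp only [Finset.mul_sum]
  rw [adjTriples, Finset.card_filter]
  push_cast
  rw [Fintype.sum_prod_type]
  refine Finset.sum_congr rfl fun x _ => ?_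
  rw [Fintype.sum_prod_type]
  refine Finset.sum_congr rfl fun y _ => Finset.sum_congr rfl fun z _ => ?_
  simp only [adjInd]
  by_cases h1 : H.Adj x y <;> by_cases h2 : H.Adj x z <;> by_cases h3 : H.Adj y z <;>
    simp [h1, h2, h3]

/-- `tr (A ^ 3) ^ 2 ≤ tr (A ^ 2) ^ 3` for the adjacency matrix `A`. -/
theorem card_adjTriples_sq_le : (#(adjTriples H) : ℝ) ^ 2 ≤ (#(adjPairs H) : ℝ) ^ 3 := by
  rw [card_adjTriples_eq, ← Fintype.sum_prod_type']
  -- Cauchy–Schwarz over ordered pairs, separating adjacency from the number of common neighbours.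
  refine (Finset.sum_mul_sq_le_sq_mul_sq _ _ _).trans ?_
  have e1 : ∑ q : V × V, adjInd H q.1 q.2 ^ 2 = #(adjPairs H) := by
    rw [card_adjPairs_eq, ← Fintype.sum_prod_type']
    exact Finset.sum_congr rfl fun q _ => adjInd_sq H _ _
  -- The number of common neighbours of x and y is at most deg x and at most deg y, so its square is
  -- at most deg x · deg y.
  have e2 : ∑ q : V × V, (∑ z, adjInd H q.1 z * adjInd H q.2 z) ^ 2 ≤ (#(adjPairs H) : ℝ) ^ 2 := by
    rw [card_adjPairs_eq, Fintype.sum_prod_type]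
    calc ∑ x, ∑ y, (∑ z, adjInd H x z * adjInd H y z) ^ 2
        ≤ ∑ x, ∑ y, (∑ z, adjInd H x z) * ∑ w, adjInd H y w := by
          refine Finset.sum_le_sum fun x _ => Finset.sum_le_sum fun y _ => ?_
          rw [sq]
          refine mul_le_mul ?_ ?_ ?_ ?_
          · exact Finset.sum_le_sum fun z _ =>
              mul_le_of_le_one_right (adjInd_mem H x z).1 (adjInd_mem H y z).2
          · exact Finset.sum_le_sum fun z _ =>
              mul_le_of_le_one_left (adjInd_mem H y z).1 (adjInd_mem H x z).2
          · exact Finset.sum_nonneg fun z _ =>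
              mul_nonneg (adjInd_mem H x z).1 (adjInd_mem H y z).1
          · exact Finset.sum_nonneg fun z _ => (adjInd_mem H x z).1
      _ = (∑ x, ∑ y, adjInd H x y) ^ 2 := by
          rw [sq, Finset.sum_mul_sum]
  rw [e1]
  calc (#(adjPairs H) : ℝ) * ∑ q : V × V, (∑ z, adjInd H q.1 z * adjInd H q.2 z) ^ 2
      ≤ #(adjPairs H) * (#(adjPairs H) : ℝ) ^ 2 := by gcongr
    _ = _ := by ring

open Classical in
theorem cherries_eq_sum :
    cherries H = ∑ v, (#{u | H.Adj v u}).choose 2 := by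
  rw [cherries, card_eq_sum_card_fiberwise (f := Prod.fst) (t := univ) (by simp)]
  refine Finset.sum_congr rfl fun v _ => ?_
  rw [← card_powersetCard]
  refine card_bij (fun p _ => p.2) ?_ ?_ ?_
  · rintro ⟨w, s⟩ h
    obtain ⟨h', rfl⟩ := mem_filter.1 h
    have h' := (mem_filter.1 h').2
    exact mem_powersetCard.2 ⟨fun u hu => mem_filter.2 ⟨mem_univ _, h'.2 u hu⟩, h'.1⟩
  · rintro ⟨w, s⟩ h ⟨w', s'⟩ h' e
    obtain ⟨-, rfl⟩ := mem_filter.1 h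
    obtain ⟨-, h2⟩ := mem_filter.1 h'
    exact Prod.ext h2.symm e
  · intro s hs
    obtain ⟨h1, h2⟩ := mem_powersetCard.1 hs
    refine ⟨(v, s), ?_, rfl⟩
    exact mem_filter.2 ⟨mem_filter.2 ⟨mem_univ _, h2, fun u hu => (mem_filter.1 (h1 hu)).2⟩, rfl⟩

open Classical in
theorem choose_le_cherries (v : V) : (#{u | H.Adj v u}).choose 2 ≤ cherries H := by
  rw [cherries_eq_sum]
  exact Finset.single_le_sum (f := fun v => (#{u | H.Adj v u}).choose 2)
    (fun _ _ => Nat.zero_le _) (mem_univ v)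

theorem cherries_le : cherries H ≤ Fintype.card V * #(adjPairs H) := by
  classical
  have e : #(adjPairs H) = ∑ v, #{u | H.Adj v u} := by
    rw [adjPairs, card_eq_sum_card_fiberwise (f := Prod.fst) (t := univ) (by simp)]
    refine Finset.sum_congr rfl fun v _ => ?_
    refine card_bij (fun p _ => p.2) ?_ ?_ ?_
    · rintro ⟨w, s⟩ h
      obtain ⟨h', rfl⟩ := mem_filter.1 h
      exact mem_filter.2 ⟨mem_univ _, (mem_filter.1 h').2⟩
    · rintro ⟨w, s⟩ h ⟨w', s'⟩ h' e
      obtain ⟨-, rfl⟩ := mem_filter.1 h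
      obtain ⟨-, h2⟩ := mem_filter.1 h'
      exact Prod.ext h2.symm e
    · intro s hs
      exact ⟨(v, s), mem_filter.2 ⟨mem_filter.2 ⟨mem_univ _, (mem_filter.1 hs).2⟩, rfl⟩, rfl⟩
  rw [cherries_eq_sum, e, Finset.mul_sum]
  refine Finset.sum_le_sum fun v _ => ?_
  rw [Nat.choose_two_right]
  have h1 : #{u | H.Adj v u} ≤ Fintype.card V := card_le_univ _
  calc #{u | H.Adj v u} * (#{u | H.Adj v u} - 1) / 2
      ≤ #{u | H.Adj v u} * (#{u | H.Adj v u} - 1) := Nat.div_le_self _ _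
    _ ≤ #{u | H.Adj v u} * Fintype.card V := Nat.mul_le_mul_left _ ((Nat.sub_le _ _).trans h1)
    _ = _ := mul_comm _ _

end counts

section

variable {G : Multigraph}

theorem mem_natEdges_iff (u v : Fin G.order) : s((u : ℕ), (v : ℕ)) ∈ G.natEdges ↔
    s(u, v) ∈ G.edges := by
  rw [natEdges, ← Sym2.map_mk]
  exact Multiset.mem_map_of_injective (Sym2.map.injective Fin.val_injective)

theorem simplification_adj (u v : Fin G.order) :
    G.simplification.Adj u v ↔ (u : ℕ) ≠ v ∧ s((u : ℕ), (v : ℕ)) ∈ G.natEdges := by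
  rw [simplification, SimpleGraph.fromEdgeSet_adj, Set.mem_ofPred_eq, mem_natEdges_iff, Ne,
    Fin.ext_iff, and_comm]

theorem card_adjPairs_simplification :
    (#(adjPairs G.simplification) : ℝ) = ∑ q ∈ (range G.order).offDiag, link q.1 q.2 G := by
  classical
  simp only [link]
  rw [← Nat.cast_one, ← Nat.cast_zero]
  simp only [← Nat.cast_ite]
  rw [← Nat.cast_sum, ← Finset.card_filter]
  congr 1
  refine card_bij (fun q _ => ((q.1 : ℕ), (q.2 : ℕ))) ?_ ?_ ?_
  · rintro ⟨u, v⟩ h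
    have h := (simplification_adj u v).1 (mem_filter.1 h).2
    exact mem_filter.2 ⟨mem_offDiag.2 ⟨mem_range.2 u.2, mem_range.2 v.2, h.1⟩, h.2⟩
  · rintro ⟨u, v⟩ _ ⟨u', v'⟩ _ h
    simpa [Fin.ext_iff] using h
  · rintro ⟨i, j⟩ h
    obtain ⟨h1, h2⟩ := mem_filter.1 h
    obtain ⟨hi, hj, hij⟩ := mem_offDiag.1 h1
    exact ⟨(⟨i, mem_range.1 hi⟩, ⟨j, mem_range.1 hj⟩),
      mem_filter.2 ⟨mem_univ _, (simplification_adj _ _).2 ⟨hij, h2⟩⟩, rfl⟩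

theorem card_adjPairs_le_linkSum {θ c : ℝ} (hc : 0 ≤ c) :
    (#(adjPairs G.simplification) : ℝ) ≤ linkSum θ c G := by
  rw [card_adjPairs_simplification, linkSum]
  refine Finset.sum_le_sum fun q _ => ?_
  have := link_mem q.1 q.2 G
  rw [linkPotential]
  have : 0 ≤ (1 - link q.1 q.2 G) * (degPow θ q.1 G * degPow θ q.2 G) :=
    mul_nonneg (by linarith) (mul_nonneg (degPow_nonneg _ _ _) (degPow_nonneg _ _ _))
  nlinarith [mul_nonneg hc this]

theorem order_le_powSum {θ : ℝ} (h0 : 0 ≤ θ) (hG : ∀ n < G.order, 1 ≤ G.deg n) :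
    (G.order : ℝ) ≤ powSum θ G := by
  have : ∑ i ∈ range G.order, (1 : ℝ) ≤ powSum θ G := Finset.sum_le_sum fun i hi =>
    Real.one_le_rpow (by exact_mod_cast hG i (mem_range.1 hi)) h0
  simpa using this

theorem choose_neighborCount_le {i : ℕ} (hi : i < G.order) :
    (neighborCount i G).choose 2 ≤ cherries G.simplification := by
  classical
  refine le_trans (le_of_eq ?_) (choose_le_cherries G.simplification ⟨i, hi⟩)
  congr 1
  symm
  refine card_bij (fun u _ => (u : ℕ)) ?_ ?_ ?_
  · intro u h
    have h := (simplification_adj _ u).1 (mem_filter.1 h).2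
    exact mem_filter.2 ⟨mem_range.2 u.2, Ne.symm h.1, h.2⟩
  · intro u _ v _ h
    exact Fin.ext h
  · intro j h
    obtain ⟨h1, h2, h3⟩ := mem_filter.1 h
    exact ⟨⟨j, mem_range.1 h1⟩, mem_filter.2 ⟨mem_univ _,
      (simplification_adj _ _).2 ⟨Ne.symm h2, h3⟩⟩, rfl⟩

/-- The number of ordered pairs of different labels below `N` that are not linked. -/
noncomputable def unlinkCount (N : ℕ) (G : Multigraph) : ℝ :=
  ∑ q ∈ (range N).offDiag, (1 - link q.1 q.2 G)

theorem unlinkCount_nonneg (N : ℕ) (G : Multigraph) : 0 ≤ unlinkCount N G :=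
  Finset.sum_nonneg fun q _ => by linarith [link_mem q.1 q.2 G]

/-- A triple of labels below `N` either is a triangle or contains a bad pair in one of three
positions, with at most `N` choices for the third entry. Labels not yet present count as unlinked,
so `N` may exceed the order. -/
theorem le_triangles (N : ℕ) :
    (N : ℝ) ^ 3 - 3 * N * (N + unlinkCount N G) ≤ 27 * triangles G.simplification := by
  classical
  set R := range N ×ˢ range N ×ˢ range N with hR
  set good : Finset (ℕ × ℕ × ℕ) := {q ∈ R | (q.1 ≠ q.2.1 ∧ s(q.1, q.2.1) ∈ G.natEdges) ∧
    (q.1 ≠ q.2.2 ∧ s(q.1, q.2.2) ∈ G.natEdges) ∧ (q.2.1 ≠ q.2.2 ∧ s(q.2.1, q.2.2) ∈ G.natEdges)}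
    with hgood
  -- Diagonal pairs are bad as well; they account for the extra `N` beside `unlinkCount`.
  set bad : Finset (ℕ × ℕ) := {q ∈ range N ×ˢ range N | ¬(q.1 ≠ q.2 ∧ s(q.1, q.2) ∈ G.natEdges)}
    with hbad
  have h1 : #good ≤ #(adjTriples G.simplification) := by
    refine card_le_card_of_surjOn (fun q => ((q.1 : ℕ), (q.2.1 : ℕ), (q.2.2 : ℕ))) ?_
    rintro ⟨a, b, c⟩ h
    obtain ⟨-, h1, h2, h3⟩ := mem_filter.1 (mem_coe.1 h)
    have ha := (G.lt_order_of_mem h1.2).1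
    have hb := (G.lt_order_of_mem h1.2).2
    have hc := (G.lt_order_of_mem h2.2).2
    refine ⟨(⟨a, ha⟩, ⟨b, hb⟩, ⟨c, hc⟩), ?_, rfl⟩
    rw [mem_coe, adjTriples, mem_filter]
    exact ⟨mem_univ _, (simplification_adj _ _).2 h1, (simplification_adj _ _).2 h2,
      (simplification_adj _ _).2 h3⟩
  have h2 : (#bad : ℝ) ≤ N + unlinkCount N G := by
    have e : (unlinkCount N G) =
        (#{q ∈ (range N).offDiag | s(q.1, q.2) ∉ G.natEdges} : ℕ) := by
      rw [unlinkCount, Finset.card_filter]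
      push_cast
      refine Finset.sum_congr rfl fun q _ => ?_
      rw [link]
      split_ifs <;> simp_all
    rw [e]
    have : #bad ≤ #(range N) + #{q ∈ (range N).offDiag | s(q.1, q.2) ∉ G.natEdges} := by
      have e : #((range N).image fun i => (i, i)) ≤ #(range N) := card_image_le
      refine (card_le_card ?_).trans ((card_union_le _ _).trans (Nat.add_le_add_right e _))
      rintro ⟨a, b⟩ h
      simp only [hbad, mem_filter, mem_product, mem_union, mem_image, mem_offDiag,
        Prod.mk.injEq] at h ⊢
      by_cases hab : a = b
      · exact Or.inl ⟨a, h.1.1, rfl, hab⟩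
      · exact Or.inr ⟨⟨h.1.1, h.1.2, hab⟩, fun hh => h.2 ⟨hab, hh⟩⟩
    rw [card_range] at this
    exact_mod_cast this
  have h3 : #R ≤ #good + 3 * (#bad * N) := by
    have e1 : #((bad ×ˢ range N).image fun q => (q.1.1, q.1.2, q.2)) ≤ #bad * N :=
      card_image_le.trans (by rw [card_product, card_range])
    have e2 : #((bad ×ˢ range N).image fun q => (q.1.1, q.2, q.1.2)) ≤ #bad * N :=
      card_image_le.trans (by rw [card_product, card_range])
    have e3 : #((bad ×ˢ range N).image fun q => (q.2, q.1.1, q.1.2)) ≤ #bad * N :=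
      card_image_le.trans (by rw [card_product, card_range])
    have hsub : R ⊆ good ∪ ((bad ×ˢ range N).image (fun q => (q.1.1, q.1.2, q.2)) ∪
        ((bad ×ˢ range N).image (fun q => (q.1.1, q.2, q.1.2)) ∪
          (bad ×ˢ range N).image fun q => (q.2, q.1.1, q.1.2))) := by
      rintro ⟨a, b, c⟩ h
      have hm : a ∈ range N ∧ b ∈ range N ∧ c ∈ range N := by
        simpa only [hR, mem_product] using h
      by_cases g1 : a ≠ b ∧ s(a, b) ∈ G.natEdges
      · by_cases g2 : a ≠ c ∧ s(a, c) ∈ G.natEdges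
        · by_cases g3 : b ≠ c ∧ s(b, c) ∈ G.natEdges
          · exact mem_union_left _ (mem_filter.2 ⟨h, g1, g2, g3⟩)
          · refine mem_union_right _ (mem_union_right _ (mem_union_right _ (mem_image.2
              ⟨((b, c), a), mem_product.2 ⟨mem_filter.2 ⟨mem_product.2 ⟨hm.2.1, hm.2.2⟩, g3⟩, hm.1⟩,
                rfl⟩)))
        · refine mem_union_right _ (mem_union_right _ (mem_union_left _ (mem_image.2
              ⟨((a, c), b), mem_product.2 ⟨mem_filter.2 ⟨mem_product.2 ⟨hm.1, hm.2.2⟩, g2⟩, hm.2.1⟩,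
                rfl⟩)))
      · refine mem_union_right _ (mem_union_left _ (mem_image.2
              ⟨((a, b), c), mem_product.2 ⟨mem_filter.2 ⟨mem_product.2 ⟨hm.1, hm.2.1⟩, g1⟩, hm.2.2⟩,
                rfl⟩))
    have := (card_le_card hsub).trans ((card_union_le _ _).trans (Nat.add_le_add_left
      ((card_union_le _ _).trans (Nat.add_le_add_left (card_union_le _ _) _)) _))
    omega
  have h4 : #R = N ^ 3 := by
    rw [hR, card_product, card_product, card_range]; ring
  have h5 := h1.trans (card_adjTriples_le _)
  have h3' : (N : ℝ) ^ 3 ≤ #good + 3 * (#bad * N) := by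
    rw [h4] at h3
    exact_mod_cast h3
  have h5' : (#good : ℝ) ≤ 27 * triangles G.simplification := by exact_mod_cast h5
  have h6 : (#bad : ℝ) * N ≤ (N + unlinkCount N G) * N := by gcongr
  linarith

end

end EdgeStep

/-! ### Power bounds for regularly varying functions, and elementary asymptotics. -/

namespace EdgeStep

open Filter

section

variable {f : ℝ → ℝ} {γ ε : ℝ}

/-- Only the ratio at a = 2 is used: beyond a threshold, each doubling multiplies `f` by at most
2^(-γ+ε). Up to twice the threshold, f ≤ 1 suffices, because γ ≤ 1 gives x^(-γ+ε) ≥ 1/x. -/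
theorem IsRegularlyVarying.exists_le_rpow (hf : IsRegularlyVarying f (-γ)) (hf1 : ∀ x, f x ≤ 1)
    (hγ : γ ≤ 1) (hε : 0 < ε) :
    ∃ C > 0, ∀ x, 1 ≤ x → f x ≤ C * x ^ (-γ + ε) := by
  have h1 : ∀ᶠ x in atTop, f (2 * x) / f x < (2 : ℝ) ^ (-γ + ε) :=
    (hf.2 2 two_pos).eventually_lt_const
      (Real.rpow_lt_rpow_of_exponent_lt one_lt_two (by linarith))
  obtain ⟨X, hX⟩ := eventually_atTop.1 h1
  set X₀ := max X 1 with hX₀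
  have hX1 : 1 ≤ X₀ := le_max_right _ _
  refine ⟨2 * X₀, by positivity, ?_⟩
  -- Induction on the number of halvings that bring `x` into the initial range.
  have key : ∀ k : ℕ, ∀ x, 1 ≤ x → x ≤ 2 ^ k * (2 * X₀) → f x ≤ 2 * X₀ * x ^ (-γ + ε) := by
    intro k
    induction k with
    | zero =>
      intro x hx hx'
      have h2 : 1 ≤ 2 * X₀ * x ^ (-γ + ε) := by
        have h3 : x ^ (-1 : ℝ) ≤ x ^ (-γ + ε) :=
          Real.rpow_le_rpow_of_exponent_le hx (by linarith)
        rw [Real.rpow_neg_one] at h3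
        have h4 : 1 ≤ 2 * X₀ * x⁻¹ := by
          rw [← div_eq_mul_inv, le_div_iff₀ (by linarith)]
          linarith
        exact h4.trans (by gcongr)
      exact (hf1 x).trans h2
    | succ k ih =>
      intro x hx hx'
      rcases le_total x (2 * X₀) with h | h
      · exact ih x hx (h.trans (le_mul_of_one_le_left (by positivity) (one_le_pow₀ one_le_two)))
      · have h2 := ih (x / 2) (by linarith) (by rw [pow_succ] at hx'; linarith)
        have h3 := hX (x / 2) ((le_max_left X 1).trans (by linarith))
        have h4 := hf.1 (x / 2) (by linarith)
        rw [div_lt_iff₀ h4, mul_div_cancel₀ _ two_ne_zero] at h3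
        calc f x ≤ 2 ^ (-γ + ε) * f (x / 2) := h3.le
          _ ≤ 2 ^ (-γ + ε) * (2 * X₀ * (x / 2) ^ (-γ + ε)) := by gcongr
          _ = 2 * X₀ * x ^ (-γ + ε) := by
            rw [Real.div_rpow (by linarith) two_pos.le]
            field_simp
  intro x hx
  obtain ⟨k, hk⟩ := pow_unbounded_of_one_lt x one_lt_two
  exact key k x hx (hk.le.trans (le_mul_of_one_le_right (by positivity) (by linarith)))

/-- The same doubling argument from below; on the initial range monotonicity provides the positive
lower bound. -/
theorem IsRegularlyVarying.exists_rpow_le (hf : IsRegularlyVarying f (-γ))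
    (hanti : AntitoneOn f (Set.Ioi 0)) (hγ : 0 ≤ γ) (hε : 0 < ε) :
    ∃ c > 0, ∀ x, 1 ≤ x → c * x ^ (-γ - ε) ≤ f x := by
  have h1 : ∀ᶠ x in atTop, (2 : ℝ) ^ (-γ - ε) < f (2 * x) / f x :=
    (hf.2 2 two_pos).eventually_const_lt
      (Real.rpow_lt_rpow_of_exponent_lt one_lt_two (by linarith))
  obtain ⟨X, hX⟩ := eventually_atTop.1 h1
  set X₀ := max X 1 with hX₀
  have hX1 : 1 ≤ X₀ := le_max_right _ _
  have hc := hf.1 (2 * X₀) (by positivity)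
  refine ⟨f (2 * X₀), hc, ?_⟩
  have key : ∀ k : ℕ, ∀ x, 1 ≤ x → x ≤ 2 ^ k * (2 * X₀) →
      f (2 * X₀) * x ^ (-γ - ε) ≤ f x := by
    intro k
    induction k with
    | zero =>
      intro x hx hx'
      rw [pow_zero, one_mul] at hx'
      refine le_trans ?_ (hanti (Set.mem_Ioi.2 (by linarith)) (Set.mem_Ioi.2 (by linarith)) hx')
      exact mul_le_of_le_one_right hc.le (Real.rpow_le_one_of_one_le_of_nonpos hx (by linarith))
    | succ k ih =>
      intro x hx hx'
      rcases le_total x (2 * X₀) with h | h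
      · exact ih x hx (h.trans (le_mul_of_one_le_left (by positivity) (one_le_pow₀ one_le_two)))
      · have h2 := ih (x / 2) (by linarith) (by rw [pow_succ] at hx'; linarith)
        have h3 := hX (x / 2) ((le_max_left X 1).trans (by linarith))
        have h4 := hf.1 (x / 2) (by linarith)
        rw [lt_div_iff₀ h4, mul_div_cancel₀ _ two_ne_zero] at h3
        calc f (2 * X₀) * x ^ (-γ - ε)
            = 2 ^ (-γ - ε) * (f (2 * X₀) * (x / 2) ^ (-γ - ε)) := by
              rw [Real.div_rpow (by linarith) two_pos.le]
              field_simp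
          _ ≤ 2 ^ (-γ - ε) * f (x / 2) := by gcongr
          _ ≤ f x := h3.le
  intro x hx
  obtain ⟨k, hk⟩ := pow_unbounded_of_one_lt x one_lt_two
  exact key k x hx (hk.le.trans (le_mul_of_one_le_right (by positivity) (by linarith)))

end

theorem eventually_mul_rpow_le_div_log {κ : ℝ} (hκ : 0 < κ) (K : ℝ) {M : ℝ} (hM : 0 < M) :
    ∀ᶠ t : ℕ in atTop, K * (t : ℝ) ^ (-κ) ≤ 1 / (M * Real.log t) := by
  have h : ∀ᶠ x : ℝ in atTop, K * x ^ (-κ) ≤ 1 / (M * Real.log x) := by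
    have h1 := (isLittleO_log_rpow_atTop hκ).def (c := 1 / ((|K| + 1) * M)) (by positivity)
    filter_upwards [h1, eventually_gt_atTop 1] with x hx hx1
    have hlog := Real.log_pos hx1
    have hxk : 0 < x ^ κ := by positivity
    rw [Real.norm_of_nonneg hlog.le, Real.norm_of_nonneg hxk.le, div_mul_eq_mul_div, one_mul,
      le_div_iff₀ (by positivity)] at hx
    rw [Real.rpow_neg (by linarith), ← div_eq_mul_inv, div_le_div_iff₀ hxk (by positivity), one_mul]
    refine le_trans ?_ hx
    have : K ≤ |K| + 1 := (le_abs_self K).trans (by linarith)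
    have h3 : 0 ≤ M * Real.log x := by positivity
    nlinarith [mul_le_mul_of_nonneg_right this h3]
  exact tendsto_natCast_atTop_atTop.eventually h

theorem eventually_exp_neg_le_div_log {κ c : ℝ} (hκ : 0 < κ) (hc : 0 < c) {M : ℝ} (hM : 0 < M) :
    ∀ᶠ t : ℕ in atTop, Real.exp (-(c * (t : ℝ) ^ κ)) ≤ 1 / (M * Real.log t) := by
  filter_upwards [eventually_mul_rpow_le_div_log hκ c⁻¹ hM, eventually_ge_atTop 1] with t ht ht1
  refine le_trans ?_ ht
  have ht0 : (0 : ℝ) < t := by exact_mod_cast ht1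
  have h : 0 < c * (t : ℝ) ^ κ := by positivity
  rw [Real.rpow_neg ht0.le, ← mul_inv, Real.exp_neg]
  have := Real.add_one_le_exp (c * (t : ℝ) ^ κ)
  exact inv_anti₀ h (by linarith)

theorem eventually_le_rpow (K : ℝ) {κ : ℝ} (hκ : 0 < κ) :
    ∀ᶠ t : ℕ in atTop, K ≤ (t : ℝ) ^ κ :=
  ((tendsto_rpow_atTop hκ).comp tendsto_natCast_atTop_atTop).eventually_ge_atTop K

theorem eventually_rpow_le_mul_rpow {a b c : ℝ} (hab : a < b) (hc : 0 < c) :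
    ∀ᶠ t : ℕ in atTop, (t : ℝ) ^ a ≤ c * (t : ℝ) ^ b := by
  filter_upwards [eventually_le_rpow c⁻¹ (sub_pos.2 hab), eventually_ge_atTop 1] with t ht ht1
  have ht0 : (0 : ℝ) < t := by exact_mod_cast ht1
  have e : (t : ℝ) ^ b = (t : ℝ) ^ a * (t : ℝ) ^ (b - a) := by
    rw [← Real.rpow_add ht0]; congr 1; ring
  rw [e]
  have h1 : 1 ≤ c * (t : ℝ) ^ (b - a) := by
    have := mul_le_mul_of_nonneg_left ht hc.le
    rwa [mul_inv_cancel₀ hc.ne'] at this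
  have h2 : 0 ≤ (t : ℝ) ^ a := by positivity
  nlinarith

end EdgeStep

/-! ### Combining the growth phases. -/

namespace EdgeStep

open Multigraph Filter

section

variable {f : ℝ → unitInterval}

/-- During `k₁` steps the degree reaches `x`, up to the first error term; during `k₂` further steps
a vertex of that degree collects neighbours. -/
theorem ev_neighborCount_lt_le {τ : ℝ} (hτ : 0 < τ) (hτ' : τ ≤ 1 / 2) {s k₁ k₂ i : ℕ}
    {H : Multigraph} (hH : Inv s H) (hi : i < H.order)
    (hf : ∀ u : ℕ, s ≤ u → (f ((u : ℝ) + 1) : ℝ) + 1 / ((u : ℝ) + 1) ≤ 2 * τ) {x φ : ℝ}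
    (hx : 0 < x) (hφ : 0 ≤ φ) (hf' : ∀ u : ℕ, u < s + k₁ + k₂ → φ ≤ f ((u : ℝ) + 1)) (y : ℝ) :
    ev f s (k₁ + k₂) (fun G => indic ((neighborCount i G : ℝ) < y)) H ≤
      Real.exp τ * x ^ τ * (((s : ℝ) + 1) / (s + k₁ + 1)) ^ (τ * (1 - 2 * τ)) +
        Real.exp y * Real.exp (-(φ * (x / (4 * (((s + k₁ : ℕ) : ℝ) + k₂ + 1))))) ^ k₂ := by
  rw [ev_comp]
  set b := Real.exp y * Real.exp (-(φ * (x / (4 * (((s + k₁ : ℕ) : ℝ) + k₂ + 1))))) ^ k₂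
  have h1 := ev_mono (f := f) (preserved_inv.and (preserved_lt_order i)) (s := s) (k := k₁)
    (h := ev f (s + k₁) k₂ fun G => indic ((neighborCount i G : ℝ) < y))
    (h' := fun G => indic ((G.deg i : ℝ) < x) + b) (fun G hG => by
      by_cases hd : (G.deg i : ℝ) < x
      · rw [indic_of hd]
        have h2 := ev_mono (f := f) (k := k₂) (h := fun G => indic ((neighborCount i G : ℝ) < y))
          (h' := fun _ => 1) preserved_inv (fun _ _ => indic_le_one _) hG.1
        rw [ev_const] at h2
        have hb : 0 ≤ b := by positivity
        linarith
      · rw [indic_not hd, zero_add]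
        refine (ev_indic_count_lt_le G (neighborCount i) y).trans ?_
        exact mul_le_mul_of_nonneg_left
          (ev_neighborCount_le hG.1 hG.2 hφ hf' hx.le (not_lt.1 hd)) (Real.exp_pos _).le)
    ⟨hH, hi⟩
  rw [ev_add_fun, ev_const] at h1
  exact h1.trans (add_le_add (ev_deg_lt_le hτ hτ' hH hi hf hx) le_rfl)

theorem ev_unlink_le_of_add {τ : ℝ} (hτ : 0 < τ) (hτ' : τ ≤ 1 / 4) {s k₁ k₂ i j : ℕ}
    {H : Multigraph} (hH : Inv s H) (hi : i < H.order) (hj : j < H.order) (hij : i ≠ j)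
    (hf : ∀ u : ℕ, s ≤ u → (f ((u : ℝ) + 1) : ℝ) + 1 / ((u : ℝ) + 1) ≤ 2 * τ) {x : ℝ}
    (hx : 0 < x) :
    ev f s (k₁ + k₂) (fun G => 1 - link i j G) H ≤
      2 * (Real.exp τ * x ^ τ * (((s : ℝ) + 1) / (s + k₁ + 1)) ^ (τ * (1 - 2 * τ))) +
        Real.exp (-(x / (2 * (((s + k₁ : ℕ) : ℝ) + k₂ + 1))) ^ 2) ^ k₂ := by
  rw [ev_comp]
  set b := Real.exp (-(x / (2 * (((s + k₁ : ℕ) : ℝ) + k₂ + 1))) ^ 2) ^ k₂ with hb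
  have h1 := ev_mono (f := f) ((preserved_inv.and (preserved_lt_order i)).and
      (preserved_lt_order j)) (s := s) (k := k₁)
    (h := ev f (s + k₁) k₂ fun G => 1 - link i j G)
    (h' := fun G => (indic ((G.deg i : ℝ) < x) + indic ((G.deg j : ℝ) < x)) + b) (fun G hG => by
      have hb0 : 0 ≤ b := by positivity
      have h2 := ev_mono (f := f) (k := k₂) (h := fun G => 1 - link i j G)
        (h' := fun _ => 1) preserved_inv (fun G _ => by linarith [link_mem i j G]) hG.1.1
      rw [ev_const] at h2
      by_cases hd : (G.deg i : ℝ) < x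
      · rw [indic_of hd]
        linarith [indic_nonneg ((G.deg j : ℝ) < x)]
      by_cases hd' : (G.deg j : ℝ) < x
      · rw [indic_of hd']
        linarith [indic_nonneg ((G.deg i : ℝ) < x)]
      rw [indic_not hd, indic_not hd', add_zero, zero_add]
      refine ev_unlink_le hG.1.1 hG.1.2 hG.2 hij (fun u hu => ?_) hx.le (not_lt.1 hd)
        (not_lt.1 hd')
      have := hf u ((Nat.le_add_right _ _).trans hu)
      have h3 : 0 ≤ 1 / ((u : ℝ) + 1) := by positivity
      linarith)
    ⟨⟨hH, hi⟩, hj⟩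
  rw [ev_add_fun, ev_add_fun, ev_const] at h1
  refine h1.trans ?_
  have h3 := ev_deg_lt_le (k := k₁) hτ (by linarith) hH hi hf hx
  have h4 := ev_deg_lt_le (k := k₁) hτ (by linarith) hH hj hf hx
  linarith

/-- Three phases: by time `s` at least `N` vertices are born, in `k₁` steps their degrees reach `x`,
in `k₂` steps they are linked. Each pair has the same bound, so Markov's inequality at the level
N²/12 costs only the factor 12, with no union bound over pairs. -/
theorem ev_unlinkCount_le {τ : ℝ} (hτ : 0 < τ) (hτ' : τ ≤ 1 / 4) {s k₁ k₂ N : ℕ} (hN : 0 < N)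
    (hf : ∀ u : ℕ, s ≤ u → (f ((u : ℝ) + 1) : ℝ) + 1 / ((u : ℝ) + 1) ≤ 2 * τ) {x φ : ℝ}
    (hx : 0 < x) (hf' : ∀ u : ℕ, u < s → φ ≤ f ((u : ℝ) + 1)) {y : ℝ} (hy : (N : ℝ) < y + 1) :
    ev f 0 (s + (k₁ + k₂)) (fun G => indic ((N : ℝ) ^ 2 / 12 < unlinkCount N G)) initialGraph ≤
      Real.exp y * Real.exp (-(φ / 2)) ^ s +
      12 * (2 * (Real.exp τ * x ^ τ * (((s : ℝ) + 1) / (s + k₁ + 1)) ^ (τ * (1 - 2 * τ))) +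
        Real.exp (-(x / (2 * (((s + k₁ : ℕ) : ℝ) + k₂ + 1))) ^ 2) ^ k₂) := by
  rw [ev_comp, zero_add]
  set b := 2 * (Real.exp τ * x ^ τ * (((s : ℝ) + 1) / (s + k₁ + 1)) ^ (τ * (1 - 2 * τ))) +
        Real.exp (-(x / (2 * (((s + k₁ : ℕ) : ℝ) + k₂ + 1))) ^ 2) ^ k₂ with hb
  have hN0 : (0 : ℝ) < N := by exact_mod_cast hN
  have h1 := ev_mono (f := f) preserved_inv (s := 0) (k := s)
    (h := ev f s (k₁ + k₂) fun G => indic ((N : ℝ) ^ 2 / 12 < unlinkCount N G))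
    (h' := fun G => indic ((G.order : ℝ) < y) + 12 * b) (fun G hG => by
      rw [zero_add] at hG
      have hb0 : 0 ≤ b := by positivity
      by_cases hd : (G.order : ℝ) < y
      · rw [indic_of hd]
        have h2 := ev_mono (f := f) (k := k₁ + k₂)
          (h := fun G => indic ((N : ℝ) ^ 2 / 12 < unlinkCount N G))
          (h' := fun _ => 1) preserved_inv (fun G _ => indic_le_one _) hG
        rw [ev_const] at h2
        linarith
      · rw [indic_not hd, zero_add]
        have hNo : N ≤ G.order := by
          have : (N : ℝ) < G.order + 1 := by linarith
          exact Nat.lt_succ_iff.1 (by exact_mod_cast this)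
        refine (ev_indic_le_div (f := f) (k := k₁ + k₂) preserved_inv hG (unlinkCount_nonneg N)
          (y := (N : ℝ) ^ 2 / 12) (by positivity) (fun G _ h => h.le)).trans ?_
        rw [div_le_iff₀ (by positivity)]
        have h3 : ev f s (k₁ + k₂) (unlinkCount N) G ≤ (N : ℝ) ^ 2 * b := by
          have e : unlinkCount N = fun G => ∑ q ∈ (Finset.range N).offDiag,
            (1 - link q.1 q.2 G) := rfl
          rw [e, ev_sum]
          refine (Finset.sum_le_card_nsmul _ _ b fun q hq => ?_).trans ?_
          · obtain ⟨hi, hj, hij⟩ := Finset.mem_offDiag.1 hq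
            have hi := (Finset.mem_range.1 hi).trans_le hNo
            have hj := (Finset.mem_range.1 hj).trans_le hNo
            exact ev_unlink_le_of_add hτ hτ' hG hi hj hij hf hx
          · rw [nsmul_eq_mul]
            refine mul_le_mul_of_nonneg_right ?_ hb0
            rw [Finset.offDiag_card, Finset.card_range, sq]
            exact_mod_cast Nat.sub_le _ _
        linarith)
    inv_initialGraph
  rw [ev_add_fun, ev_const] at h1
  refine h1.trans (add_le_add ?_ le_rfl)
  exact (ev_indic_count_lt_le initialGraph (fun G => G.order) y).trans
    (mul_le_mul_of_nonneg_left (ev_order_le hf') (Real.exp_pos _).le)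

theorem exists_forall_add_inv_le (hlim : Tendsto (fun x => (f x : ℝ)) atTop (nhds 0)) {η : ℝ}
    (hη : 0 < η) :
    ∃ s₀ : ℕ, ∀ u : ℕ, s₀ ≤ u → (f ((u : ℝ) + 1) : ℝ) + 1 / ((u : ℝ) + 1) ≤ η := by
  have h1 : Tendsto (fun x : ℝ => (f x : ℝ) + 1 / x) atTop (nhds (0 + 0)) :=
    hlim.add (tendsto_const_nhds.div_atTop tendsto_id)
  rw [add_zero] at h1
  have h2 : Tendsto (fun u : ℕ => (u : ℝ) + 1) atTop atTop :=
    tendsto_atTop_add_const_right _ _ tendsto_natCast_atTop_atTop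
  exact eventually_atTop.1 ((h1.comp h2).eventually_le_const hη)

/-- Evaluates the degree tail at scale: growth from time t^(1-b) to t exceeds t^a with polynomially
small failure probability as soon as a < b(1 - 2τ). -/
theorem rpow_mul_ratio_le {τ t x r a b D : ℝ} (hτ : 0 < τ) (hτ' : τ ≤ 1 / 2) (ht : 1 ≤ t)
    (hx : x = t ^ a) (hr : 0 ≤ r) (hD : 1 ≤ D) (hrD : r ≤ D * t ^ (-b)) :
    Real.exp τ * x ^ τ * r ^ (τ * (1 - 2 * τ)) ≤
      3 * D * t ^ (-(τ * (b * (1 - 2 * τ) - a))) := by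
  have ht0 : 0 < t := by linarith
  have hκ : 0 ≤ τ * (1 - 2 * τ) := mul_nonneg hτ.le (by linarith)
  have h1 : Real.exp τ ≤ 3 := by
    have h2 := Real.exp_le_exp.2 (show τ ≤ 1 by linarith)
    have := Real.exp_one_lt_d9
    linarith
  have h2 : r ^ (τ * (1 - 2 * τ)) ≤ D * t ^ (-b * (τ * (1 - 2 * τ))) := by
    refine (Real.rpow_le_rpow hr hrD hκ).trans ?_
    rw [Real.mul_rpow (by linarith) (by positivity), ← Real.rpow_mul ht0.le]
    refine mul_le_mul_of_nonneg_right ?_ (by positivity)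
    calc D ^ (τ * (1 - 2 * τ)) ≤ D ^ (1 : ℝ) :=
          Real.rpow_le_rpow_of_exponent_le hD (by nlinarith)
      _ = D := Real.rpow_one D
  have h3 : x ^ τ = t ^ (a * τ) := by rw [hx, ← Real.rpow_mul ht0.le]
  rw [h3]
  calc Real.exp τ * t ^ (a * τ) * r ^ (τ * (1 - 2 * τ))
      ≤ 3 * t ^ (a * τ) * (D * t ^ (-b * (τ * (1 - 2 * τ)))) := by gcongr
    _ = 3 * D * (t ^ (a * τ) * t ^ (-b * (τ * (1 - 2 * τ)))) := by ring
    _ = _ := by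
      rw [← Real.rpow_add ht0]
      congr 2
      ring

theorem le_of_antitoneOn (hanti : AntitoneOn f (Set.Ioi 0)) {T u : ℕ} (hu : u < T) :
    (f T : ℝ) ≤ f ((u : ℝ) + 1) := by
  have h1 : (u : ℝ) + 1 ≤ T := by exact_mod_cast hu
  have h2 : (0 : ℝ) < (u : ℝ) + 1 := by positivity
  exact_mod_cast hanti (Set.mem_Ioi.2 h2) (Set.mem_Ioi.2 (h2.trans_le h1)) h1

/-- From a constant time on, vertex 0 reaches degree t^(1-ε) by t/2. It is then hit by
vertex-operations about t^(θ-1-ε) · t^(1-ε) = t^(θ-2ε) times, well above the required t^(θ-3ε). -/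
theorem eventually_ev_neighborCount_lt_le (hanti : AntitoneOn f (Set.Ioi 0))
    (hlim : Tendsto (fun x => (f x : ℝ)) atTop (nhds 0)) {θ ε c : ℝ} (hε : 0 < ε)
    (hε' : ε ≤ 1 / 2) (hθ : 2 * ε < θ) (hc : 0 < c)
    (hlow : ∀ x, 1 ≤ x → c * x ^ (θ - 1 - ε) ≤ f x) :
    ∀ᶠ t : ℕ in atTop,
      ev f 0 t (fun G => indic ((neighborCount 0 G : ℝ) < (t : ℝ) ^ (θ - 3 * ε))) initialGraph ≤
        1 / (4 * Real.log t) := by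
  -- Small enough that 1 - 2τ exceeds 1 - ε, as the degree bound t^(1-ε) requires.
  set τ := ε / 8 with hτ
  have hτ0 : 0 < τ := by positivity
  obtain ⟨s₀, hs₀⟩ := exists_forall_add_inv_le hlim (η := 2 * τ) (by positivity)
  set D : ℝ := 2 * (s₀ + 1) with hD
  filter_upwards [eventually_ge_atTop (2 * s₀ + 1), eventually_ge_atTop 2,
    eventually_mul_rpow_le_div_log (κ := τ * (1 * (1 - 2 * τ) - (1 - ε))) (by
      refine mul_pos hτ0 ?_
      rw [hτ]; linarith) (3 * D) (M := 8) (by norm_num),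
    eventually_exp_neg_le_div_log (κ := θ - 2 * ε) (c := c / 32) (by linarith) (by positivity)
      (M := 8) (by norm_num),
    eventually_rpow_le_mul_rpow (a := θ - 3 * ε) (b := θ - 2 * ε) (c := c / 32) (by linarith)
      (by positivity)] with t ht1 ht2 h1 h2 h3
  obtain ⟨k₁, hk₁⟩ := Nat.exists_eq_add_of_le (show s₀ ≤ t / 2 by omega)
  obtain ⟨k₂, hk₂⟩ := Nat.exists_eq_add_of_le (show t / 2 ≤ t by omega)
  have htk : t = s₀ + (k₁ + k₂) := by omega
  have ht1' : (1 : ℝ) ≤ t := by exact_mod_cast (by omega : 1 ≤ t)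
  have ht0 : (0 : ℝ) < t := by linarith
  have hcast : ((s₀ + k₁ : ℕ) : ℝ) + k₂ + 1 = t + 1 := by
    rw [htk]; push_cast; ring
  have hk₂' : (t : ℝ) ≤ 2 * k₂ := by exact_mod_cast (by omega : t ≤ 2 * k₂)
  have hmid : (t : ℝ) ≤ 2 * ((s₀ : ℝ) + k₁ + 1) := by
    exact_mod_cast (by omega : t ≤ 2 * (s₀ + k₁ + 1))
  set x : ℝ := (t : ℝ) ^ (1 - ε) with hx
  set φ : ℝ := c * (t : ℝ) ^ (θ - 1 - ε) with hφ
  set y : ℝ := (t : ℝ) ^ (θ - 3 * ε) with hy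
  set B : ℝ := Real.exp τ * x ^ τ * (((s₀ : ℝ) + 1) / (s₀ + k₁ + 1)) ^ (τ * (1 - 2 * τ)) +
        Real.exp y * Real.exp (-(φ * (x / (4 * (((s₀ + k₁ : ℕ) : ℝ) + k₂ + 1))))) ^ k₂ with hB
  have key : ev f 0 t (fun G => indic ((neighborCount 0 G : ℝ) < y)) initialGraph ≤ B := by
    rw [htk, ev_comp]
    have h4 := ev_mono (f := f) (preserved_inv.and (preserved_lt_order 0)) (s := 0) (k := s₀)
      (h := ev f (0 + s₀) (k₁ + k₂) fun G => indic ((neighborCount 0 G : ℝ) < y))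
      (h' := fun _ => B) (H := initialGraph) (fun G hG => by
        rw [zero_add] at hG ⊢
        refine ev_neighborCount_lt_le hτ0 (by rw [hτ]; linarith) hG.1 hG.2 hs₀ (by positivity)
          (by positivity) (fun u hu => ?_) y
        exact (hlow t ht1').trans (le_of_antitoneOn hanti (by omega)))
      ⟨inv_initialGraph, Nat.one_pos⟩
    rw [ev_const] at h4
    exact h4
  refine key.trans ?_
  have b1 : Real.exp τ * x ^ τ * (((s₀ : ℝ) + 1) / (s₀ + k₁ + 1)) ^ (τ * (1 - 2 * τ)) ≤
      1 / (8 * Real.log t) := by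
    refine (rpow_mul_ratio_le (D := D) (b := 1) hτ0 (by rw [hτ]; linarith) ht1' hx
      (by positivity) ?_ ?_).trans h1
    · have : (0 : ℝ) ≤ s₀ := by positivity
      rw [hD]; linarith
    · rw [Real.rpow_neg_one, ← div_eq_mul_inv, div_le_div_iff₀ (by positivity) ht0, hD]
      nlinarith [mul_le_mul_of_nonneg_left hmid (show (0 : ℝ) ≤ s₀ + 1 by positivity)]
  have b2 : Real.exp y * Real.exp (-(φ * (x / (4 * (((s₀ + k₁ : ℕ) : ℝ) + k₂ + 1))))) ^ k₂ ≤
      1 / (8 * Real.log t) := by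
    refine le_trans ?_ h2
    rw [hcast, ← Real.exp_nat_mul, ← Real.exp_add, Real.exp_le_exp]
    have e : φ * x = c * (t : ℝ) ^ (θ - 2 * ε) := by
      rw [hφ, hx, mul_assoc, ← Real.rpow_add ht0]
      congr 2
      ring
    have e' : (k₂ : ℝ) * -(φ * (x / (4 * ((t : ℝ) + 1)))) =
        -(c * (t : ℝ) ^ (θ - 2 * ε) * (k₂ / (4 * ((t : ℝ) + 1)))) := by
      rw [← e]; ring
    have h5 : 1 / 16 ≤ (k₂ : ℝ) / (4 * ((t : ℝ) + 1)) := by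
      rw [div_le_div_iff₀ (by norm_num) (by positivity)]
      linarith
    have h6 : 0 ≤ c * (t : ℝ) ^ (θ - 2 * ε) := by positivity
    have h7 := mul_le_mul_of_nonneg_left h5 h6
    rw [e']
    linarith
  have e : 1 / (4 * Real.log t) = 1 / (8 * Real.log t) + 1 / (8 * Real.log t) := by
    rw [one_div, one_div, mul_inv, mul_inv]; ring
  rw [e]
  exact add_le_add b1 b2

/-- The number of births by time s ≈ t^(1/2-ε) is about s^(θ-ε), and (1/2-ε)(θ-ε) ≥ θ/2 - 3ε/2
because θ ≤ 1. This beats the required number y. -/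
theorem exp_mul_exp_pow_le {θ ε c t : ℝ} {s : ℕ} (hc : 0 < c) (hε : 0 < ε)
    (hθ : 4 * ε < θ) (hθ1 : θ ≤ 1) (ht1' : 1 ≤ t) (hs1R : (1 : ℝ) ≤ s)
    (hslt : t ^ (1 / 2 - ε) ≤ s + 1) {y : ℝ} (h3 : y ≤ c / 8 * t ^ (θ / 2 - 3 / 2 * ε)) :
    Real.exp y * Real.exp (-(c * (s : ℝ) ^ (θ - 1 - ε) / 2)) ^ s ≤
      Real.exp (-(c / 8 * t ^ (θ / 2 - 3 / 2 * ε))) := by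
  have ht0 : 0 < t := one_pos.trans_le ht1'
  rw [← Real.exp_nat_mul, ← Real.exp_add, Real.exp_le_exp]
  have e : (s : ℝ) * (c * (s : ℝ) ^ (θ - 1 - ε)) = c * (s : ℝ) ^ (θ - ε) := by
    rw [show θ - ε = 1 + (θ - 1 - ε) by ring, Real.rpow_add (by linarith), Real.rpow_one]
    ring
  have h5 : 1 / 2 * t ^ (θ / 2 - 3 / 2 * ε) ≤ (s : ℝ) ^ (θ - ε) := by
    have h6 : t ^ (1 / 2 - ε) / 2 ≤ s := by linarith
    have h7 := Real.rpow_le_rpow (by positivity) h6 (show 0 ≤ θ - ε by linarith)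
    refine le_trans ?_ h7
    rw [Real.div_rpow (by positivity) (by norm_num), ← Real.rpow_mul ht0.le]
    have h8 : (2 : ℝ) ^ (θ - ε) ≤ 2 := by
      calc (2 : ℝ) ^ (θ - ε) ≤ 2 ^ (1 : ℝ) :=
            Real.rpow_le_rpow_of_exponent_le one_le_two (by linarith)
        _ = 2 := Real.rpow_one 2
    have h9 : t ^ (θ / 2 - 3 / 2 * ε) ≤ t ^ ((1 / 2 - ε) * (θ - ε)) :=
      Real.rpow_le_rpow_of_exponent_le ht1' (by nlinarith)
    rw [le_div_iff₀ (by positivity)]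
    calc 1 / 2 * t ^ (θ / 2 - 3 / 2 * ε) * 2 ^ (θ - ε)
        ≤ 1 / 2 * t ^ ((1 / 2 - ε) * (θ - ε)) * 2 := by gcongr
      _ = _ := by ring
  have e' : (s : ℝ) * -(c * (s : ℝ) ^ (θ - 1 - ε) / 2) = -(c * (s : ℝ) ^ (θ - ε)) / 2 := by rw [← e]; ring
  have h10 := mul_le_mul_of_nonneg_left h5 hc.le
  rw [e']
  linarith

/-- Two vertices of degree t^(1/2+ε/2) are joined with probability of order t^(ε-1) per step, so
about t/2 steps leave exp(-t^ε/32). -/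
theorem exp_neg_sq_pow_le {ε t : ℝ} {k : ℕ} (ht : 1 ≤ t) (hk : t ≤ 2 * k) :
    Real.exp (-(t ^ (1 / 2 + ε / 2) / (2 * (t + 1))) ^ 2) ^ k ≤
      Real.exp (-(1 / 32 * t ^ ε)) := by
  have ht0 : 0 < t := one_pos.trans_le ht
  rw [← Real.exp_nat_mul, Real.exp_le_exp]
  have e : (t ^ (1 / 2 + ε / 2)) ^ 2 = t * t ^ ε := by
    rw [← Real.rpow_natCast, ← Real.rpow_mul ht0.le,
      show (1 / 2 + ε / 2) * ((2 : ℕ) : ℝ) = 1 + ε by push_cast; ring, Real.rpow_add ht0,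
      Real.rpow_one]
  have e' : (k : ℝ) * -(t ^ (1 / 2 + ε / 2) / (2 * (t + 1))) ^ 2 =
      -(t ^ ε * (k * t / (4 * (t + 1) ^ 2))) := by
    rw [div_pow, e]; field_simp; ring
  have h5 : 1 / 32 ≤ (k : ℝ) * t / (4 * (t + 1) ^ 2) := by
    rw [div_le_div_iff₀ (by norm_num) (by positivity)]
    nlinarith
  have h6 := mul_le_mul_of_nonneg_left h5 (show 0 ≤ t ^ ε by positivity)
  rw [e']
  linarith

theorem eventually_ev_unlinkCount_le (hanti : AntitoneOn f (Set.Ioi 0))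
    (hlim : Tendsto (fun x => (f x : ℝ)) atTop (nhds 0)) {θ ε c : ℝ} (hε : 0 < ε)
    (hε' : ε ≤ 1 / 4) (hθ : 4 * ε < θ) (hθ1 : θ ≤ 1) (hc : 0 < c)
    (hlow : ∀ x, 1 ≤ x → c * x ^ (θ - 1 - ε) ≤ f x) :
    ∀ᶠ t : ℕ in atTop, ∀ N : ℕ, N = ⌈(t : ℝ) ^ (θ / 2 - 2 * ε)⌉₊ →
      ev f 0 t (fun G => indic ((N : ℝ) ^ 2 / 12 < unlinkCount N G)) initialGraph ≤
        1 / (4 * Real.log t) := by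
  set τ := ε / 8 with hτ
  have hτ0 : 0 < τ := by positivity
  have hτ4 : τ ≤ 1 / 4 := by rw [hτ]; linarith
  obtain ⟨s₀, hs₀⟩ := exists_forall_add_inv_le hlim (η := 2 * τ) (by positivity)
  -- Growing from time t^(1/2-ε) to t/2 gains about t^(1/2+ε), which leaves room for the target
  -- degree t^(1/2+ε/2).
  have hκ : 0 < τ * ((1 / 2 + ε) * (1 - 2 * τ) - (1 / 2 + ε / 2)) := by
    refine mul_pos hτ0 ?_
    rw [hτ]
    nlinarith
  filter_upwards [eventually_ge_atTop 2, eventually_le_rpow (s₀ + 1 : ℝ)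
      (κ := 1 / 2 - ε) (by linarith),
    eventually_rpow_le_mul_rpow (a := 1 / 2 - ε) (b := 1) (c := 1 / 4) (by linarith) (by norm_num),
    eventually_mul_rpow_le_div_log hκ (24 * (3 * 4)) (M := 12) (by norm_num),
    eventually_exp_neg_le_div_log (κ := θ / 2 - 3 / 2 * ε) (c := c / 8) (by linarith)
      (by positivity) (M := 12) (by norm_num),
    eventually_rpow_le_mul_rpow (a := θ / 2 - 2 * ε) (b := θ / 2 - 3 / 2 * ε) (c := c / 8)
      (by linarith) (by positivity),
    eventually_exp_neg_le_div_log (κ := ε) (c := 1 / 32) hε (by norm_num) (M := 144)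
      (by norm_num)] with t ht2 hs1 hs2 h1 h2 h3 h4 N hN
  have ht1' : (1 : ℝ) ≤ t := by exact_mod_cast (by omega : 1 ≤ t)
  have ht0 : (0 : ℝ) < t := one_pos.trans_le ht1'
  set s : ℕ := ⌊(t : ℝ) ^ (1 / 2 - ε)⌋₊ with hs
  have hsle : (s : ℝ) ≤ (t : ℝ) ^ (1 / 2 - ε) := Nat.floor_le (by positivity)
  have hslt : (t : ℝ) ^ (1 / 2 - ε) < s + 1 := Nat.lt_floor_add_one _
  have hs1' : s₀ + 1 ≤ s := Nat.le_floor (by push_cast; exact hs1)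
  have hs1R : (1 : ℝ) ≤ s := by exact_mod_cast (by omega : 1 ≤ s)
  have hst : 4 * s ≤ t := by
    rw [Real.rpow_one] at hs2
    have : (4 * s : ℝ) ≤ t := by linarith
    exact_mod_cast this
  obtain ⟨k₁, hk₁⟩ := Nat.exists_eq_add_of_le (show s ≤ t / 2 by omega)
  obtain ⟨k₂, hk₂⟩ := Nat.exists_eq_add_of_le (show t / 2 ≤ t by omega)
  have htk : t = s + (k₁ + k₂) := by omega
  have hcast : ((s + k₁ : ℕ) : ℝ) + k₂ + 1 = t + 1 := by
    have : (t : ℝ) = s + (k₁ + k₂) := by exact_mod_cast htk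
    push_cast
    linarith
  have hk₂' : (t : ℝ) ≤ 2 * k₂ := by exact_mod_cast (by omega : t ≤ 2 * k₂)
  have hmid : (t : ℝ) ≤ 2 * ((s : ℝ) + k₁ + 1) := by
    exact_mod_cast (by omega : t ≤ 2 * (s + k₁ + 1))
  set x : ℝ := (t : ℝ) ^ (1 / 2 + ε / 2) with hx
  set φ : ℝ := c * (s : ℝ) ^ (θ - 1 - ε) with hφ
  set y : ℝ := (t : ℝ) ^ (θ / 2 - 2 * ε) with hy
  have hy0 : 0 < y := by positivity
  have hNpos : 0 < N := by rw [hN]; exact Nat.ceil_pos.2 hy0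
  have hNy : (N : ℝ) < y + 1 := by rw [hN]; exact Nat.ceil_lt_add_one hy0.le
  have key := ev_unlinkCount_le (f := f) hτ0 hτ4 (s := s) (k₁ := k₁) (k₂ := k₂) hNpos
    (fun u hu => hs₀ u (by omega)) (x := x) (φ := φ) (by positivity)
    (fun u hu => (hlow s hs1R).trans (le_of_antitoneOn hanti hu)) hNy
  rw [← htk] at key
  refine key.trans ?_
  have b0 : Real.exp y * Real.exp (-(φ / 2)) ^ s ≤ 1 / (12 * Real.log t) := by
    exact (exp_mul_exp_pow_le hc hε hθ hθ1 ht1' hs1R hslt.le h3).trans h2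
  have b1 : Real.exp τ * x ^ τ * (((s : ℝ) + 1) / (s + k₁ + 1)) ^ (τ * (1 - 2 * τ)) ≤
      1 / (24 * (12 * Real.log t)) := by
    refine (rpow_mul_ratio_le (D := 4) (b := 1 / 2 + ε) hτ0 (by linarith) ht1' hx
      (by positivity) (by norm_num) ?_).trans ?_
    · have e : (t : ℝ) ^ (1 / 2 - ε) = t * (t : ℝ) ^ (-(1 / 2 + ε)) := by
        rw [show 1 / 2 - ε = 1 + -(1 / 2 + ε) by ring, Real.rpow_add ht0, Real.rpow_one]
      rw [div_le_iff₀ (by positivity)]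
      have h5 : (s : ℝ) + 1 ≤ 2 * (t * (t : ℝ) ^ (-(1 / 2 + ε))) := by rw [← e]; linarith
      have h6 := mul_le_mul_of_nonneg_right hmid
        (show 0 ≤ (t : ℝ) ^ (-(1 / 2 + ε)) by positivity)
      linarith
    · rw [← one_div_mul_one_div, one_div_mul_eq_div, le_div_iff₀ (by norm_num)]
      refine le_trans (le_of_eq ?_) h1
      ring
  have b2 : Real.exp (-(x / (2 * (((s + k₁ : ℕ) : ℝ) + k₂ + 1))) ^ 2) ^ k₂ ≤
      1 / (144 * Real.log t) := by
    rw [hcast]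
    exact (exp_neg_sq_pow_le ht1' hk₂').trans h4
  have e : 1 / (4 * Real.log t) = 1 / (12 * Real.log t) + 12 * (2 * (1 / (24 * (12 * Real.log t)))
      + 1 / (144 * Real.log t)) := by
    simp only [one_div, mul_inv]; ring
  rw [e]
  gcongr

end

end EdgeStep

/-! ### Assembly. -/

namespace EdgeStep

open Multigraph Filter

/-- The deterministic end of the argument: the four good events bound Δ and Λ from both sides. The
factors are 1/18 = 3/54 and 12 = 3 · 4, so in the end the constants do not even depend on δ. -/
theorem globalClustering_mem {G : Multigraph} {θ ε t : ℝ} {N : ℕ} (ht : 1 ≤ t) (hε : 0 ≤ ε)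
    (hG : 0 < G.order)
    (h1 : (G.order : ℝ) ≤ t ^ (θ + 3 * ε))
    (h2 : ((adjPairs G.simplification).card : ℝ) ≤ t ^ (θ + 3 * ε))
    (h3 : t ^ (θ - 3 * ε) ≤ neighborCount 0 G) (h3' : (2 : ℝ) ≤ t ^ (θ - 3 * ε))
    (h4 : unlinkCount N G ≤ (N : ℝ) ^ 2 / 12) (h5 : t ^ (θ / 2 - 2 * ε) ≤ N) (h5' : (12 : ℝ) ≤ N) :
    1 / 18 * t ^ (-(θ / 2 + 12 * ε)) ≤ globalClustering G ∧
      globalClustering G ≤ 12 * t ^ (-(θ / 2 - 12 * ε)) := by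
  have ht0 : 0 < t := one_pos.trans_le ht
  set Δ : ℝ := (triangles G.simplification : ℝ) with hΔ
  set Λ : ℝ := (cherries G.simplification : ℝ) with hΛ
  set m : ℝ := ((adjPairs G.simplification).card : ℝ) with hm
  have hm0 : 0 ≤ m := by positivity
  have cherries_upper : Λ ≤ t ^ (2 * θ + 6 * ε) := by
    have h := cherries_le G.simplification
    rw [Fintype.card_fin] at h
    have h' : Λ ≤ G.order * m := by
      rw [hΛ, hm]; exact_mod_cast h
    calc Λ ≤ G.order * m := h'
      _ ≤ t ^ (θ + 3 * ε) * t ^ (θ + 3 * ε) := by gcongr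
      _ = _ := by rw [← Real.rpow_add ht0]; congr 1; ring
  have cherries_lower : t ^ (2 * θ - 6 * ε) / 4 ≤ Λ := by
    have h : (((neighborCount 0 G).choose 2 : ℕ) : ℝ) ≤ Λ := by
      rw [hΛ]; exact_mod_cast choose_neighborCount_le hG
    rw [Nat.cast_choose_two] at h
    set n : ℝ := (neighborCount 0 G : ℝ)
    have e : t ^ (2 * θ - 6 * ε) = t ^ (θ - 3 * ε) * t ^ (θ - 3 * ε) := by
      rw [← Real.rpow_add ht0]; congr 1; ring
    have h6 : t ^ (θ - 3 * ε) * t ^ (θ - 3 * ε) ≤ n * n := by gcongr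
    -- Two or more neighbours give n(n-1)/2 ≥ n²/4.
    rw [e]
    nlinarith
  have triangles_upper : Δ ≤ t ^ (3 / 2 * θ + 9 / 2 * ε) := by
    refine abs_le_of_sq_le_sq' ?_ (by positivity) |>.2
    have h6 : Δ ≤ (adjTriples G.simplification).card := by
      rw [hΔ]; exact_mod_cast triangles_le G.simplification
    calc Δ ^ 2 ≤ ((adjTriples G.simplification).card : ℝ) ^ 2 := by gcongr
      _ ≤ m ^ 3 := card_adjTriples_sq_le _
      _ ≤ (t ^ (θ + 3 * ε)) ^ 3 := by gcongr
      _ = (t ^ (3 / 2 * θ + 9 / 2 * ε)) ^ 2 := by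
        rw [← Real.rpow_natCast, ← Real.rpow_natCast, ← Real.rpow_mul ht0.le,
          ← Real.rpow_mul ht0.le]
        congr 1
        push_cast
        ring
  have triangles_lower : t ^ (3 / 2 * θ - 6 * ε) / 54 ≤ Δ := by
    have h6 := le_triangles (G := G) N
    have h7 : (t ^ (θ / 2 - 2 * ε)) ^ 3 ≤ (N : ℝ) ^ 3 := by gcongr
    have e : (t ^ (θ / 2 - 2 * ε)) ^ 3 = t ^ (3 / 2 * θ - 6 * ε) := by
      rw [← Real.rpow_natCast, ← Real.rpow_mul ht0.le]
      congr 1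
      push_cast
      ring
    rw [e] at h7
    -- N ≥ 12 gives 3N² ≤ N³/4, and the unlinked pairs contribute at most another N³/4.
    have h8 : 3 * (N : ℝ) * (N + unlinkCount N G) ≤ (N : ℝ) ^ 3 / 2 := by
      calc 3 * (N : ℝ) * (N + unlinkCount N G) ≤ 3 * N * (N + (N : ℝ) ^ 2 / 12) := by gcongr
        _ ≤ (N : ℝ) ^ 3 / 2 := by nlinarith [mul_nonneg (sq_nonneg (N : ℝ)) (sub_nonneg.2 h5')]
    linarith
  have hΛ0 : 0 < Λ := lt_of_lt_of_le (by positivity) cherries_lower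
  rw [globalClustering, ← hΔ, ← hΛ]
  constructor
  · rw [← mul_div_assoc, le_div_iff₀ hΛ0]
    calc 1 / 18 * t ^ (-(θ / 2 + 12 * ε)) * Λ
        ≤ 1 / 18 * t ^ (-(θ / 2 + 12 * ε)) * t ^ (2 * θ + 6 * ε) := by gcongr
      _ = 3 * (t ^ (3 / 2 * θ - 6 * ε) / 54) := by
        rw [mul_assoc, ← Real.rpow_add ht0,
          show -(θ / 2 + 12 * ε) + (2 * θ + 6 * ε) = 3 / 2 * θ - 6 * ε by ring]
        ring
      _ ≤ 3 * Δ := by gcongr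
  · rw [← mul_div_assoc, div_le_iff₀ hΛ0]
    calc 3 * Δ ≤ 3 * t ^ (3 / 2 * θ + 9 / 2 * ε) := by gcongr
      _ ≤ 3 * t ^ (-(θ / 2 - 12 * ε) + (2 * θ - 6 * ε)) := by
        gcongr ?_ * ?_
        -- The actual loss is 21ε/2; it is rounded up to the 12ε of the lower bound.
        exact Real.rpow_le_rpow_of_exponent_le ht (by linarith)
      _ = 12 * t ^ (-(θ / 2 - 12 * ε)) * (t ^ (2 * θ - 6 * ε) / 4) := by
        rw [Real.rpow_add ht0]; ring
      _ ≤ 12 * t ^ (-(θ / 2 - 12 * ε)) * Λ := by gcongr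

theorem eventually_ev_indic_lt_le {f : ℝ → unitInterval} {a b A : ℝ} (hab : b < a)
    (h : ℕ → Multigraph → ℝ) (h0 : ∀ t G, 0 ≤ h t G) (P : ℕ → Multigraph → Prop)
    (hP : ∀ t : ℕ, ∀ G, Inv t G → P t G → (t : ℝ) ^ a ≤ h t G)
    (hA : ∀ t : ℕ, 1 ≤ t → ev f 0 t (h t) initialGraph ≤ A * (t : ℝ) ^ b) :
    ∀ᶠ t : ℕ in atTop, ev f 0 t (fun G => indic (P t G)) initialGraph ≤ 1 / (4 * Real.log t) := by
  filter_upwards [eventually_ge_atTop 1,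
    eventually_mul_rpow_le_div_log (sub_pos.2 hab) A (M := 4) (by norm_num)] with t ht h1
  have ht0 : (0 : ℝ) < t := by exact_mod_cast ht
  refine le_trans ?_ h1
  refine (ev_indic_le_div (f := f) preserved_inv inv_initialGraph (h0 t) (y := (t : ℝ) ^ a)
    (by positivity) (fun G hG => hP t G (by rwa [zero_add] at hG))).trans ?_
  rw [div_le_iff₀ (by positivity), mul_assoc, ← Real.rpow_add ht0]
  refine (hA t ht).trans (le_of_eq ?_)
  congr 2
  ring

end EdgeStep

open EdgeStep EdgeStep.Multigraph Filter in
theorem theorem3 (δ : ℝ) (hδ : δ ∈ Set.Ioo (0 : ℝ) 1) :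
    ∃ c₁ > (0 : ℝ), ∃ c₂ > (0 : ℝ),
      ∀ (γ : ℝ) (_ : γ ∈ Set.Ico (0 : ℝ) 1) (f : ℝ → unitInterval)
        (_ : AntitoneOn f (Set.Ioi 0))
        (_ : Filter.Tendsto (fun x => (f x : ℝ)) Filter.atTop (nhds 0))
        (_ : EdgeStep.IsRegularlyVarying (fun x => (f x : ℝ)) (-γ)),
        ∀ᶠ t : ℕ in Filter.atTop,
          1 - 1 / Real.log t ≤
            (EdgeStep.graphLaw f t).toMeasure.real
              {G | c₁ * (t : ℝ) ^ (-((1 - γ) * (1 + δ) / 2)) ≤ EdgeStep.globalClustering G ∧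
                EdgeStep.globalClustering G ≤ c₂ * (t : ℝ) ^ (-((1 - γ) * (1 - δ) / 2))} := by
  refine ⟨1 / 18, by norm_num, 12, by norm_num, fun γ hγ f hanti hlim hreg => ?_⟩
  obtain ⟨θ, hθ⟩ : ∃ θ, θ = 1 - γ := ⟨_, rfl⟩
  have hθ0 : 0 < θ := by linarith [hγ.2]
  have hθ1 : θ ≤ 1 := by linarith [hγ.1]
  -- Chosen so that the total loss 12ε in the exponent equals θδ/2.
  obtain ⟨ε, hε⟩ : ∃ ε, ε = θ * δ / 24 := ⟨_, rfl⟩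
  have hε0 : 0 < ε := by have := hδ.1; rw [hε]; positivity
  have hεθ : 24 * ε < θ := by
    have := mul_lt_mul_of_pos_left hδ.2 hθ0
    rw [hε]; linarith
  obtain ⟨C, hC, hup⟩ := hreg.exists_le_rpow (fun x => (f x).2.2) hγ.2.le hε0
  obtain ⟨c, hc, hlow⟩ := hreg.exists_rpow_le
    (fun x hx y hy hxy => by exact_mod_cast hanti hx hy hxy) hγ.1 hε0
  have hup' : ∀ n : ℕ, 1 ≤ n → (f n : ℝ) ≤ C * (n : ℝ) ^ (θ + ε - 1) := fun n hn => by
    rw [show θ + ε - 1 = -γ + ε by rw [hθ]; ring]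
    exact hup n (by exact_mod_cast hn)
  have hlow' : ∀ x : ℝ, 1 ≤ x → c * x ^ (θ - 1 - ε) ≤ f x := fun x hx => by
    rw [show θ - 1 - ε = -γ - ε by rw [hθ]; ring]
    exact hlow x hx
  obtain ⟨A, hA, hS⟩ := exists_ev_powSum_le hθ0.le hθ1 hε0 (by linarith) hC hup'
  obtain ⟨D, hD, hU⟩ := exists_ev_linkSum_le hθ0.le hθ1 hε0 (by linarith) hC hup'
  have hord := eventually_ev_indic_lt_le (f := f) (a := θ + 3 * ε) (by linarith)
    (fun _ => powSum θ) (fun _ => powSum_nonneg θ)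
    (fun t G => (t : ℝ) ^ (θ + 3 * ε) < G.order)
    (fun t G hG hP => hP.le.trans (order_le_powSum hθ0.le hG.2)) hS
  have hadj := eventually_ev_indic_lt_le (f := f) (a := θ + 3 * ε) (by linarith)
    (fun t => linkSum θ (((t : ℝ) + 1) ^ (-θ)))
    (fun t G => (Nat.cast_nonneg _).trans (card_adjPairs_le_linkSum (by positivity)))
    (fun t G => (t : ℝ) ^ (θ + 3 * ε) < (adjPairs G.simplification).card)
    (fun t G hG hP => hP.le.trans (card_adjPairs_le_linkSum (by positivity))) hU
  filter_upwards [eventually_ge_atTop 1, hord, hadj,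
    eventually_ev_neighborCount_lt_le hanti hlim hε0 (by linarith) (by linarith) hc hlow',
    eventually_ev_unlinkCount_le hanti hlim hε0 (by linarith) (by linarith) hθ1 hc hlow',
    eventually_le_rpow 2 (κ := θ - 3 * ε) (by linarith),
    eventually_le_rpow 12 (κ := θ / 2 - 2 * ε) (by linarith)] with t ht b1 b2 b3 b4 h2 h12
  have ht' : (1 : ℝ) ≤ t := by exact_mod_cast ht
  obtain ⟨N, hN⟩ : ∃ N : ℕ, N = ⌈(t : ℝ) ^ (θ / 2 - 2 * ε)⌉₊ := ⟨_, rfl⟩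
  have b4 := b4 N hN
  have hNle : (t : ℝ) ^ (θ / 2 - 2 * ε) ≤ N := by rw [hN]; exact Nat.le_ceil _
  rw [graphLaw_real_eq]
  -- The union bound: pointwise, 1 is at most the indicator of the claim plus those of the four bad
  -- events.
  have key := ev_mono (f := f) (preserved_inv.and (preserved_lt_order 0)) (s := 0) (k := t)
    (h := fun _ => 1) (h' := fun G => indic (G ∈ {G : Multigraph |
      1 / 18 * (t : ℝ) ^ (-((1 - γ) * (1 + δ) / 2)) ≤ globalClustering G ∧
        globalClustering G ≤ 12 * (t : ℝ) ^ (-((1 - γ) * (1 - δ) / 2))}) +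
      (indic ((t : ℝ) ^ (θ + 3 * ε) < G.order) +
      (indic ((t : ℝ) ^ (θ + 3 * ε) < (adjPairs G.simplification).card) +
      (indic ((neighborCount 0 G : ℝ) < (t : ℝ) ^ (θ - 3 * ε)) +
        indic ((N : ℝ) ^ 2 / 12 < unlinkCount N G))))) (H := initialGraph) (fun G hG => by
      have n0 := indic_nonneg (G ∈ {G : Multigraph |
        1 / 18 * (t : ℝ) ^ (-((1 - γ) * (1 + δ) / 2)) ≤ globalClustering G ∧
          globalClustering G ≤ 12 * (t : ℝ) ^ (-((1 - γ) * (1 - δ) / 2))})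
      have n1 := indic_nonneg ((t : ℝ) ^ (θ + 3 * ε) < G.order)
      have n2 := indic_nonneg ((t : ℝ) ^ (θ + 3 * ε) < (adjPairs G.simplification).card)
      have n3 := indic_nonneg ((neighborCount 0 G : ℝ) < (t : ℝ) ^ (θ - 3 * ε))
      have n4 := indic_nonneg ((N : ℝ) ^ 2 / 12 < unlinkCount N G)
      by_cases g1 : (t : ℝ) ^ (θ + 3 * ε) < G.order
      · rw [indic_of g1]; linarith
      by_cases g2 : (t : ℝ) ^ (θ + 3 * ε) < (adjPairs G.simplification).card
      · rw [indic_of g2]; linarith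
      by_cases g3 : (neighborCount 0 G : ℝ) < (t : ℝ) ^ (θ - 3 * ε)
      · rw [indic_of g3]; linarith
      by_cases g4 : (N : ℝ) ^ 2 / 12 < unlinkCount N G
      · rw [indic_of g4]; linarith
      have hmem := globalClustering_mem ht' hε0.le hG.2 (not_lt.1 g1) (not_lt.1 g2) (not_lt.1 g3)
        h2 (not_lt.1 g4) hNle (h12.trans hNle)
      have e1 : θ / 2 + 12 * ε = (1 - γ) * (1 + δ) / 2 := by rw [hε, ← hθ]; ring
      have e2 : θ / 2 - 12 * ε = (1 - γ) * (1 - δ) / 2 := by rw [hε, ← hθ]; ring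
      rw [e1, e2] at hmem
      rw [indic_of (P := G ∈ _) hmem]
      linarith)
    ⟨inv_initialGraph, Nat.one_pos⟩
  simp only [ev_add_fun, ev_const] at key
  have e : 1 / Real.log t = 1 / (4 * Real.log t) + 1 / (4 * Real.log t) + 1 / (4 * Real.log t) +
      1 / (4 * Real.log t) := by
    simp only [one_div, mul_inv]; ring
  rw [e]
  linarith
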